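/- Let $H$ be a complex Hilbert space and $A$ a self-adjoint operator on $H$ with $A\ge c\,\mathbb 1$ for some $c>0$ and with compact resolvent. Let $(e_k)_{k\in\mathbb N}$ be an orthonormal basis of eigenvectors, $Ae_k=\lambda_ke_k$, and let $s\ge 0$ satisfy $\sum_{k}\lambda_k^{-(s+1)}<\infty$. Let $H^{-s}$ be the completion of $H$ for the norm $\|A^{-s/2}\cdot\|_H$, regarded as a real Hilbert space with $\langle\cdot,\cdot\rangle_{H^{-s}_{\mathbb R}}=\mathrm{Re}\langle\cdot,A^{-s}\cdot\rangle_H$. The operators $e^{itA}$, $A^{-(s+1)}$ and the real pairings $\langle u,e_k\rangle$, $\langle u,ie_k\rangle$ extending $\mathrm{Re}\langle\cdot,\cdot\rangle_H$ are extended to $u\in H^{-s}$ by continuity, and $A$ maps $H^{-s}$ to $H^{-s-2}$. Let $\mathscr C^\infty_{b,cyl}(H^{-s})$ be the set of functions $F(u)=\varphi(\langle u,e_1\rangle,\dots,\langle u,e_n\rangle;\langle u,ie_1\rangle,\dots,\langle u,ie_n\rangle)$ with $n\in\mathbb N$ and $\varphi:\mathbb R^{2n}\to\mathbb R$ smooth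 and bounded together with all its derivatives; put $\nabla F(u)=\sum_{k=1}^n\big(\partial_k\varphi(\cdots)\,e_k+\partial_{n+k}\varphi(\cdots)\,ie_k\big)$, and let $\langle\cdot,\cdot\rangle$ be the real duality pairing extending $\mathrm{Re}\langle\cdot,\cdot\rangle_H$. Let $\nu_0$ be the centred Gaussian probability measure on $H^{-s}$ with $$\int_{H^{-s}} e^{i\langle u,\xi\rangle_{H^{-s}_{\mathbb R}}}\,\nu_0(du)=e^{-\frac12\langle\xi,A^{-(s+1)}\xi\rangle_{H^{-s}_{\mathbb R}}}\qquad(\xi\in H^{-s}).$$ Let $h_{NL}:H^{-s}\to\mathbb R$ belong to the Gross–Sobolev space $\mathbb D^{1,2}(\nu_0)$, with Malliavin derivative $\nabla h_{NL}\in L^2(\nu_0;H^{-s})$; that is, $(h_{NL},\nabla h_{NL})$ lies in the closure in $L^2(\nu_0)\times L^2(\nu_0;H^{-s})$ of $\{(F,\nabla F):F\in\mathscr C^\infty_{b,cyl}(H^{-s})\}$. Assume $e^{-h_{NL}}\in L^2(\nu_0)$. Put $$d\mu_0=\frac{e^{-h_{NL}}\,d\nu_0}{\int_{H^{-s}}e^{-h_{NL}}\,d\nu_0},\qquad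 \mu_t=(e^{itA})_\sharp\mu_0,\qquad v(t,u)=-i\,e^{itA}\,\nabla h_{NL}(e^{-itA}u).$$ Then: 1. $\mu_0$ is a well-defined probability measure. 2. (Stationarity.) For every $F\in\mathscr C^\infty_{b,cyl}(H^{-s})$ the function $u\mapsto\langle\nabla F(u),-iAu-i\nabla h_{NL}(u)\rangle$ is $\mu_0$-integrable and $$\int_{H^{-s}}\langle\nabla F(u),-iAu-i\nabla h_{NL}(u)\rangle\,\mu_0(du)=0.$$ 3. (Statistical Liouville equation.) The curve $(\mu_t)_{t\in\mathbb R}$ is narrowly continuous, $v(t,\cdot)$ is $\mu_t$-integrable for every $t$, the function $t\mapsto\frac1{1+t^2}\int_{H^{-s}}\|v(t,u)\|_{H^{-s}}\,\mu_t(du)$ is integrable on $\mathbb R$, and for every $t\in\mathbb R$ and every $F\in\mathscr C^\infty_{b,cyl}(H^{-s})$ the function $\tau\mapsto\int F\,d\mu_\tau$ is differentiable at $t$, $\langle v(t,\cdot),\nabla F\rangle$ is $\mu_t$-integrable, and $$\frac{d}{dt}\int_{H^{-s}}F(u)\,\mu_t(du)=\int_{H^{-s}}\langle v(t,u),\nabla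 F(u)\rangle\,\mu_t(du).$$ -/

import Mathlib

open MeasureTheory Filter Topology Complex UniformSpace
open scoped NNReal ENNReal ContDiff InnerProductSpace ComplexConjugate

noncomputable section

/-- An unbounded operator `A` has compact resolvent: for some `z`, the operator `A - z` is a
bijection from its domain onto `H` with a compact (bounded) inverse. -/
def HasCompactResolvent {H : Type*} [NormedAddCommGroup H] [InnerProductSpace ℂ H]
    (A : H →ₗ.[ℂ] H) : Prop :=
  ∃ (z : ℂ) (R : H →L[ℂ] H), IsCompactOperator R ∧
    (∀ y : H, ∃ hy : R y ∈ A.domain, A ⟨R y, hy⟩ - z • R y = y) ∧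
    ∀ x : A.domain, R (A x - z • (x : H)) = x

/-- The linear framework: a self-adjoint operator `A ≥ c > 0` with compact resolvent on a complex
Hilbert space `H`, together with a choice of an orthonormal basis `(e k)` of eigenvectors of `A`,
with eigenvalues `(lam k)`. (Such a basis exists by the spectral theorem; it is fixed here since the
cylindrical functions below refer to it.) -/
structure SpectralSetup (H : Type*) [NormedAddCommGroup H] [InnerProductSpace ℂ H]
    [CompleteSpace H] where
  A : H →ₗ.[ℂ] H
  selfAdjoint : IsSelfAdjoint A
  c : ℝ
  c_pos : 0 < c
  lower_bound : ∀ x : A.domain, c * ‖(x : H)‖ ^ 2 ≤ (inner ℂ (x : H) (A x)).re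
  compactResolvent : HasCompactResolvent A
  e : HilbertBasis ℕ ℂ H
  lam : ℕ → ℝ
  e_mem : ∀ k, e k ∈ A.domain
  eigen : ∀ k, A ⟨e k, e_mem k⟩ = (lam k : ℂ) • e k

namespace SpectralSetup

variable {H : Type*} [NormedAddCommGroup H] [InnerProductSpace ℂ H] [CompleteSpace H]

theorem c_le_lam (S : SpectralSetup H) (k : ℕ) : S.c ≤ S.lam k := by
  have h := S.lower_bound ⟨S.e k, S.e_mem k⟩
  have h1 : ‖S.e k‖ = 1 := S.e.orthonormal.1 k
  rw [S.eigen k, inner_smul_right, inner_self_eq_norm_sq_to_K] at h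
  simpa [h1] using h

theorem lam_pos (S : SpectralSetup H) (k : ℕ) : 0 < S.lam k :=
  S.c_pos.trans_le (S.c_le_lam k)

/-! ### Functions of `A` -/

/-- Multiplication of square-summable sequences by a bounded sequence. -/
def seqMul (m : ℕ → ℂ) (hm : ∃ C : ℝ, ∀ k, ‖m k‖ ≤ C) :
    lp (fun _ : ℕ => ℂ) 2 →L[ℂ] lp (fun _ : ℕ => ℂ) 2 :=
  LinearMap.mkContinuousOfExistsBound
    { toFun := fun x => ⟨fun k => m k * x k, by
        obtain ⟨C, hC⟩ := hm
        refine Memℓp.mono' ((lp.memℓp x).const_mul (C : ℂ)) fun k => ?_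
        rw [norm_mul, norm_mul, Complex.norm_real]
        exact mul_le_mul_of_nonneg_right ((hC k).trans (le_abs_self C)) (norm_nonneg _)⟩
      map_add' := fun x y => by ext k; exact mul_add (m k) (x k) (y k)
      map_smul' := fun a x => by ext k; exact mul_left_comm (m k) a (x k) }
    (by
      obtain ⟨C, hC⟩ := hm
      refine ⟨|C|, fun x => ?_⟩
      have h : ‖(⟨fun k => (C : ℂ) * x k, (lp.memℓp x).const_mul (C : ℂ)⟩ :
          lp (fun _ : ℕ => ℂ) 2)‖ = |C| * ‖x‖ := by
        rw [← Real.norm_eq_abs, ← Complex.norm_real, ← norm_smul]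
        congr 1
      rw [← h]
      refine lp.norm_mono (by norm_num) fun k => ?_
      change ‖m k * x k‖ ≤ ‖(C : ℂ) * x k‖
      rw [norm_mul, norm_mul, Complex.norm_real]
      exact mul_le_mul_of_nonneg_right ((hC k).trans (le_abs_self C)) (norm_nonneg _))

/-- The bounded operator `x ↦ ∑ₖ mₖ ⟨eₖ, x⟩ eₖ` on `H`; it is `f(A)` when `mₖ = f(lamₖ)`. -/
def diag (S : SpectralSetup H) (m : ℕ → ℂ) (hm : ∃ C : ℝ, ∀ k, ‖m k‖ ≤ C) : H →L[ℂ] H :=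
  (S.e.repr.symm.toContinuousLinearEquiv : lp (fun _ : ℕ => ℂ) 2 →L[ℂ] H) ∘L
    seqMul m hm ∘L (S.e.repr.toContinuousLinearEquiv : H →L[ℂ] lp (fun _ : ℕ => ℂ) 2)

theorem repr_diag (S : SpectralSetup H) (m : ℕ → ℂ) (hm : ∃ C : ℝ, ∀ k, ‖m k‖ ≤ C) (x : H)
    (k : ℕ) : S.e.repr (S.diag m hm x) k = m k * S.e.repr x k := by
  simp only [diag, ContinuousLinearMap.comp_apply, ContinuousLinearEquiv.coe_coe,
    LinearIsometryEquiv.coe_toContinuousLinearEquiv, LinearIsometryEquiv.apply_symm_apply]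
  rfl

/-- The multiplier of `A ^ (-r)`, for `r ≥ 0`. -/
def negPow (S : SpectralSetup H) (r : ℝ≥0) (k : ℕ) : ℂ := ((S.lam k ^ (-(r : ℝ)) : ℝ) : ℂ)

theorem negPow_bdd (S : SpectralSetup H) (r : ℝ≥0) : ∃ C : ℝ, ∀ k, ‖S.negPow r k‖ ≤ C := by
  refine ⟨S.c ^ (-(r : ℝ)), fun k => ?_⟩
  rw [negPow, Complex.norm_real, Real.norm_of_nonneg (Real.rpow_nonneg (S.lam_pos k).le _)]
  exact Real.rpow_le_rpow_of_nonpos S.c_pos (S.c_le_lam k) (by simp)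

/-- The multiplier of `e^{itA}`. -/
def expMul (S : SpectralSetup H) (t : ℝ) (k : ℕ) : ℂ := Complex.exp (t * S.lam k * I)

theorem expMul_bdd (S : SpectralSetup H) (t : ℝ) : ∃ C : ℝ, ∀ k, ‖S.expMul t k‖ ≤ C := by
  refine ⟨1, fun k => ?_⟩
  rw [expMul, ← Complex.ofReal_mul, Complex.norm_exp_ofReal_mul_I]

/-! ### The Sobolev spaces of negative exponent -/

/-- The vector space `H`, to be equipped with the norm `‖A^{-s/2} ·‖_H`. -/
def PreHneg (_S : SpectralSetup H) (_s : ℝ≥0) : Type _ := H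

instance (S : SpectralSetup H) (s : ℝ≥0) : AddCommGroup (S.PreHneg s) :=
  inferInstanceAs (AddCommGroup H)

instance (S : SpectralSetup H) (s : ℝ≥0) : Module ℂ (S.PreHneg s) :=
  inferInstanceAs (Module ℂ H)

/-- The identity map from `H` to `H` with the norm `‖A^{-s/2} ·‖_H`. -/
def toPre (S : SpectralSetup H) (s : ℝ≥0) : H ≃ₗ[ℂ] S.PreHneg s :=
  LinearEquiv.refl ℂ H

/-- The operator `A^{-s/2}`, as a map from `H` with the norm `‖A^{-s/2} ·‖_H` to `H`. -/
def weight (S : SpectralSetup H) (s : ℝ≥0) : S.PreHneg s →ₗ[ℂ] H :=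
  (S.diag (S.negPow (s / 2)) (S.negPow_bdd _) : H →ₗ[ℂ] H) ∘ₗ (S.toPre s).symm.toLinearMap

theorem repr_weight (S : SpectralSetup H) (s : ℝ≥0) (x : S.PreHneg s) (k : ℕ) :
    S.e.repr (S.weight s x) k = S.negPow (s / 2) k * S.e.repr ((S.toPre s).symm x) k :=
  S.repr_diag _ _ _ k

theorem weight_injective (S : SpectralSetup H) (s : ℝ≥0) :
    Function.Injective (S.weight s) := by
  intro x y hxy
  apply (S.toPre s).symm.injective
  apply S.e.repr.injective
  ext k
  have h : S.e.repr (S.weight s x) k = S.e.repr (S.weight s y) k := by rw [hxy]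
  rw [repr_weight, repr_weight] at h
  exact mul_left_cancel₀
    (Complex.ofReal_ne_zero.2 (Real.rpow_pos_of_pos (S.lam_pos k) _).ne') h

instance (S : SpectralSetup H) (s : ℝ≥0) : NormedAddCommGroup (S.PreHneg s) :=
  NormedAddCommGroup.induced (S.PreHneg s) H (S.weight s) (S.weight_injective s)

/-- The inner product `⟨x, y⟩_{H^{-s}} = ⟨A^{-s/2} x, A^{-s/2} y⟩_H`. -/
instance (S : SpectralSetup H) (s : ℝ≥0) : InnerProductSpace ℂ (S.PreHneg s) where
  norm_smul_le a x := by
    change ‖S.weight s (a • x)‖ ≤ ‖a‖ * ‖S.weight s x‖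
    rw [map_smul, norm_smul]
  inner x y := inner ℂ (S.weight s x) (S.weight s y)
  norm_sq_eq_re_inner x := norm_sq_eq_re_inner (𝕜 := ℂ) (S.weight s x)
  conj_inner_symm x y := inner_conj_symm (𝕜 := ℂ) (S.weight s x) (S.weight s y)
  add_left x y z := by rw [map_add, inner_add_left]
  smul_left x y a := by rw [map_smul, inner_smul_left]

/-- The Sobolev space `H^{-s}`: the completion of `(H, ‖A^{-s/2} ·‖_H)`. -/
abbrev Hneg (S : SpectralSetup H) (s : ℝ≥0) : Type _ := Completion (S.PreHneg s)

instance (S : SpectralSetup H) (s : ℝ≥0) : MeasurableSpace (S.Hneg s) := borel _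

instance (S : SpectralSetup H) (s : ℝ≥0) : BorelSpace (S.Hneg s) := ⟨rfl⟩

/-- The dense inclusion `H ⊂ H^{-s}`. -/
def emb (S : SpectralSetup H) (s : ℝ≥0) (x : H) : S.Hneg s :=
  (S.toPre s x : Completion (S.PreHneg s))

/-- The operator `diag m`, on `H` with the norm `‖A^{-s/2} ·‖_H`. -/
def preDiag (S : SpectralSetup H) (s : ℝ≥0) (m : ℕ → ℂ) (hm : ∃ C : ℝ, ∀ k, ‖m k‖ ≤ C) :
    S.PreHneg s →L[ℂ] S.PreHneg s :=
  LinearMap.mkContinuousOfExistsBound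
    ((S.toPre s).toLinearMap ∘ₗ (S.diag m hm : H →ₗ[ℂ] H) ∘ₗ (S.toPre s).symm.toLinearMap) (by
    refine ⟨‖S.diag m hm‖, fun x => ?_⟩
    have h : S.weight s (((S.toPre s).toLinearMap ∘ₗ (S.diag m hm : H →ₗ[ℂ] H) ∘ₗ
        (S.toPre s).symm.toLinearMap) x) = S.diag m hm (S.weight s x) := by
      apply S.e.repr.injective
      ext k
      rw [repr_diag, repr_weight, repr_weight]
      simp only [LinearMap.comp_apply, LinearEquiv.coe_coe, LinearEquiv.symm_apply_apply,
        ContinuousLinearMap.coe_coe, repr_diag]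
      exact mul_left_comm _ _ _
    exact (congrArg norm h).trans_le (ContinuousLinearMap.le_opNorm _ _))

/-- The continuous extension of the operator `diag m` to `H^{-s}`. -/
def diagNeg (S : SpectralSetup H) (s : ℝ≥0) (m : ℕ → ℂ) (hm : ∃ C : ℝ, ∀ k, ‖m k‖ ≤ C) :
    S.Hneg s →L[ℂ] S.Hneg s :=
  (S.preDiag s m hm).completion

/-- The linear flow `e^{itA}` on `H^{-s}`. -/
def flow (S : SpectralSetup H) (s : ℝ≥0) (t : ℝ) : S.Hneg s →L[ℂ] S.Hneg s :=
  S.diagNeg s (S.expMul t) (S.expMul_bdd t)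

/-- The operator `A^{-r}`, for `r ≥ 0`, on `H^{-s}`. -/
def powNeg (S : SpectralSetup H) (s r : ℝ≥0) : S.Hneg s →L[ℂ] S.Hneg s :=
  S.diagNeg s (S.negPow r) (S.negPow_bdd r)

/-- The coordinates `⟨eₖ, u⟩` of `u ∈ H^{-s}`, i.e. the continuous extension to `H^{-s}` of
`x ↦ ⟨eₖ, x⟩_H` (see `coord_emb`). The real numbers `⟨u, eₖ⟩` and `⟨u, i eₖ⟩`, for the real duality
pairing, are its real and imaginary parts. -/
def coord (S : SpectralSetup H) (s : ℝ≥0) (u : S.Hneg s) (k : ℕ) : ℂ :=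
  ((S.lam k ^ (s : ℝ) : ℝ) : ℂ) * inner ℂ (S.emb s (S.e k)) u

theorem coord_emb (S : SpectralSetup H) (s : ℝ≥0) (x : H) (k : ℕ) :
    S.coord s (S.emb s x) k = inner ℂ (S.e k) x := by
  have hw : S.weight s (S.toPre s (S.e k)) = S.negPow (s / 2) k • S.e k := by
    apply S.e.repr.injective
    ext j
    rw [repr_weight, LinearEquiv.symm_apply_apply, map_smul, lp.coeFn_smul, Pi.smul_apply,
      smul_eq_mul, S.e.repr_self]
    rcases eq_or_ne j k with rfl | hjk
    · rfl
    · simp [hjk]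
  have hx : inner ℂ (S.e k) (S.weight s (S.toPre s x)) =
      S.negPow (s / 2) k * inner ℂ (S.e k) x := by
    rw [← S.e.repr_apply_apply, ← S.e.repr_apply_apply, repr_weight,
      LinearEquiv.symm_apply_apply]
  have hi : inner ℂ (S.emb s (S.e k)) (S.emb s x) =
      inner ℂ (S.weight s (S.toPre s (S.e k))) (S.weight s (S.toPre s x)) :=
    Completion.inner_coe _ _
  have h0 : (s : ℝ) + (-((s / 2 : ℝ≥0) : ℝ) + -((s / 2 : ℝ≥0) : ℝ)) = 0 := by
    push_cast; ring
  have h1 : ((S.lam k ^ (s : ℝ) : ℝ) : ℂ) * (S.negPow (s / 2) k * S.negPow (s / 2) k) = 1 := by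
    rw [negPow, ← Complex.ofReal_mul, ← Complex.ofReal_mul, ← Real.rpow_add (S.lam_pos k),
      ← Real.rpow_add (S.lam_pos k), h0, Real.rpow_zero, Complex.ofReal_one]
  have h2 : conj (S.negPow (s / 2) k) = S.negPow (s / 2) k := Complex.conj_ofReal _
  rw [coord, hi, hw, inner_smul_left, hx, h2]
  linear_combination (inner ℂ (S.e k) x) * h1

/-- The real duality pairing `⟨a, x⟩ = Re ∑ₖ conj ⟨eₖ, x⟩ aₖ` of a distribution with coordinates
`a` with a vector `x`; in all uses `x` is a finite combination of the `eₖ`. -/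
def pairing (S : SpectralSetup H) (a : ℕ → ℂ) (x : H) : ℝ :=
  ∑' k, (conj (inner ℂ (S.e k) x) * a k).re

/-- The action of `A` on coordinates; it is `u ↦ A u`, from `H^{-s}` to `H^{-s-2}`. -/
def applyA (S : SpectralSetup H) (a : ℕ → ℂ) (k : ℕ) : ℂ := S.lam k * a k

/-! ### Bounded smooth cylindrical functions -/

/-- `φ` belongs to `C_b^∞(ℂⁿ) = C_b^∞(ℝ²ⁿ)`: it is real-smooth and bounded, together with all its
derivatives. -/
def IsCbInfty {n : ℕ} (φ : (Fin n → ℂ) → ℝ) : Prop :=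
  ContDiff ℝ ∞ φ ∧ ∀ m : ℕ, ∃ C : ℝ, ∀ z, ‖iteratedFDeriv ℝ m φ z‖ ≤ C

/-- The cylindrical function
`F(u) = φ(⟨u, e₁⟩, …, ⟨u, eₙ⟩; ⟨u, i e₁⟩, …, ⟨u, i eₙ⟩)` on `H^{-s}`. -/
def cyl (S : SpectralSetup H) (s : ℝ≥0) {n : ℕ} (φ : (Fin n → ℂ) → ℝ) (u : S.Hneg s) : ℝ :=
  φ fun k => S.coord s u k

/-- The gradient `∑ₖ ∂_{xₖ} φ(…) eₖ + ∑ₖ ∂_{yₖ} φ(…) i eₖ` of the cylindrical function `cyl φ`, where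
`φ` is regarded as a function of the real and imaginary parts `xₖ`, `yₖ` of its arguments. -/
def cylGrad (S : SpectralSetup H) (s : ℝ≥0) {n : ℕ} (φ : (Fin n → ℂ) → ℝ) (u : S.Hneg s) : H :=
  ∑ k : Fin n,
    (((fderiv ℝ φ (fun j => S.coord s u j) (Pi.single k 1) : ℝ) : ℂ) • S.e k +
      ((fderiv ℝ φ (fun j => S.coord s u j) (Pi.single k I) : ℝ) : ℂ) • I • S.e k)

/-! ### The Gaussian measure, the Gross-Sobolev space and the Gibbs measure -/

/-- `ν` is the centred Gaussian probability measure on `H^{-s}` with covariance `A^{-(s+1)}`,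
given by its characteristic function with respect to the real inner product of `H^{-s}`. -/
def IsGaussian (S : SpectralSetup H) (s : ℝ≥0) (ν : Measure (S.Hneg s)) : Prop :=
  IsProbabilityMeasure ν ∧ ∀ ξ : S.Hneg s,
    ∫ u, Complex.exp (I * ((inner ℂ u ξ).re : ℂ)) ∂ν =
      Complex.exp (-(1 / 2) * ((inner ℂ ξ (S.powNeg s (s + 1) ξ)).re : ℂ))

/-- `h` belongs to the Gross-Sobolev space `𝔻^{1,2}(ν)` and `g` is (a version of) its Malliavin
derivative `∇h`: the pair `(h, g)` lies in the closure in `L²(ν) × L²(ν; H^{-s})` of the graph of the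
gradient on bounded smooth cylindrical functions. -/
def IsMalliavinDeriv (S : SpectralSetup H) (s : ℝ≥0) (ν : Measure (S.Hneg s))
    (h : S.Hneg s → ℝ) (g : S.Hneg s → S.Hneg s) : Prop :=
  MemLp h 2 ν ∧ MemLp g 2 ν ∧
    ∃ (n : ℕ → ℕ) (φ : (j : ℕ) → (Fin (n j) → ℂ) → ℝ), (∀ j, IsCbInfty (φ j)) ∧
      Tendsto (fun j => eLpNorm (fun u => S.cyl s (φ j) u - h u) 2 ν) atTop (𝓝 0) ∧
      Tendsto (fun j => eLpNorm (fun u => S.emb s (S.cylGrad s (φ j) u) - g u) 2 ν)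
        atTop (𝓝 0)

/-- The Gibbs measure `μ₀ = e^{-h} ν / ∫ e^{-h} dν`. -/
def gibbs (S : SpectralSetup H) (s : ℝ≥0) (ν : Measure (S.Hneg s)) (h : S.Hneg s → ℝ) :
    Measure (S.Hneg s) :=
  (∫⁻ u, ENNReal.ofReal (Real.exp (-h u)) ∂ν)⁻¹ •
    ν.withDensity fun u => ENNReal.ofReal (Real.exp (-h u))

/-- The transported Gibbs measure `μ_t = (e^{itA})_♯ μ₀`. -/
def gibbsAt (S : SpectralSetup H) (s : ℝ≥0) (ν : Measure (S.Hneg s)) (h : S.Hneg s → ℝ) (t : ℝ) :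
    Measure (S.Hneg s) :=
  (S.gibbs s ν h).map (S.flow s t)

/-- The vector field `v(t, u) = -i e^{itA} g(e^{-itA} u)`, where `g = ∇h`. -/
def vectorField (S : SpectralSetup H) (s : ℝ≥0) (g : S.Hneg s → S.Hneg s) (t : ℝ)
    (u : S.Hneg s) : S.Hneg s :=
  -(I • S.flow s t (g (S.flow s (-t) u)))

end SpectralSetup

end

noncomputable section

namespace SpectralSetup

variable {H : Type*} [NormedAddCommGroup H] [InnerProductSpace ℂ H] [CompleteSpace H]

/-! ### Diagonal operators and coordinates on `H^{-s}` -/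

/-! Formally `μ₀` has density `e^{-⟨u, Au⟩/2 - h(u)}`, so its logarithmic derivative along `c eₖ` is
`-β_c`, where `β_c = λₖ⟨u, c eₖ⟩ + ⟨∇h(u), c eₖ⟩`. The Hamiltonian field `-i(Au + ∇h)` is this
gradient rotated by `-i`. Hence its pairing with `∇F` is the finite sum of `∂_{xₖ}φ · β_i - ∂_{yₖ}φ
· β_1`. Integrating by parts against `μ₀` turns each term into `∂_{yₖ}∂_{xₖ}φ - ∂_{xₖ}∂_{yₖ}φ = 0`,
which is stationarity.

The rigorous content is the integration by parts `integral_mul_exp_neg`. Under `ν₀` the coordinate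
along `c eₖ` is a real Gaussian independent of the orthogonal component (`IsGaussian.eq_map_prod`),
so the formula on the line gives `IsGaussian.integral_deriv`. Cylindrical approximation of `h`
extends it to weights `ψ(h)` with `ψ` and `ψ'` bounded (`integral_deriv_mul_comp`). Letting `ψ`
increase to `e^{-r}` gives the Gibbs weight.

For the Liouville equation, `F ∘ e^{itA}` is again cylindrical. Differentiating `∫ F(e^{itA}u) dμ₀`
produces the field `iAu`, and stationarity tested on `F ∘ e^{itA}` exchanges it for `-i∇h`, whose
image under `e^{itA}` is `v`. -/

theorem denseRange_emb (S : SpectralSetup H) (s : ℝ≥0) : DenseRange (S.emb s) :=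
  Completion.denseRange_coe.comp (S.toPre s).surjective.denseRange
    (Completion.continuous_coe _)

theorem norm_emb (S : SpectralSetup H) (s : ℝ≥0) (x : H) :
    ‖S.emb s x‖ = ‖S.weight s (S.toPre s x)‖ :=
  Completion.norm_coe _

/-- The dense inclusion `H ⊂ H^{-s}` as a continuous linear map. -/
def embL (S : SpectralSetup H) (s : ℝ≥0) : H →L[ℂ] S.Hneg s :=
  LinearMap.mkContinuous
    { toFun := S.emb s
      map_add' := fun x y => by
        simp only [emb, map_add]
        exact Completion.coe_add _ _
      map_smul' := fun a x => by
        simp only [emb, map_smul]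
        exact Completion.coe_smul _ _ }
    ‖S.diag (S.negPow (s / 2)) (S.negPow_bdd _)‖
    fun x => (S.norm_emb s x).trans_le
      (ContinuousLinearMap.le_opNorm (S.diag (S.negPow (s / 2)) (S.negPow_bdd _)) x)

@[simp] theorem embL_apply (S : SpectralSetup H) (s : ℝ≥0) (x : H) : S.embL s x = S.emb s x := rfl

theorem diagNeg_emb (S : SpectralSetup H) (s : ℝ≥0) (m : ℕ → ℂ) (hm : ∃ C : ℝ, ∀ k, ‖m k‖ ≤ C)
    (x : H) : S.diagNeg s m hm (S.emb s x) = S.emb s (S.diag m hm x) :=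
  ContinuousLinearMap.completion_apply_coe _ _

/-- The coordinate `u ↦ ⟨eₖ, u⟩` on `H^{-s}` as a continuous linear form. -/
def coordL (S : SpectralSetup H) (s : ℝ≥0) (k : ℕ) : S.Hneg s →L[ℂ] ℂ :=
  ((S.lam k ^ (s : ℝ) : ℝ) : ℂ) • innerSL ℂ (S.emb s (S.e k))

theorem coordL_apply (S : SpectralSetup H) (s : ℝ≥0) (k : ℕ) (u : S.Hneg s) :
    S.coordL s k u = S.coord s u k := rfl

theorem coord_diagNeg (S : SpectralSetup H) (s : ℝ≥0) (m : ℕ → ℂ)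
    (hm : ∃ C : ℝ, ∀ k, ‖m k‖ ≤ C) (u : S.Hneg s) (k : ℕ) :
    S.coord s (S.diagNeg s m hm u) k = m k * S.coord s u k := by
  simp only [← coordL_apply]
  refine (S.denseRange_emb s).induction_on u
    (isClosed_eq (by fun_prop) (by fun_prop)) fun x => ?_
  rw [diagNeg_emb, coordL_apply, coordL_apply, coord_emb, coord_emb, ← S.e.repr_apply_apply,
    ← S.e.repr_apply_apply, repr_diag]

theorem coord_emb_e (S : SpectralSetup H) (s : ℝ≥0) (j k : ℕ) :
    S.coord s (S.emb s (S.e j)) k = if k = j then 1 else 0 := by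
  rw [coord_emb]
  exact orthonormal_iff_ite.1 S.e.orthonormal k j

theorem diag_e (S : SpectralSetup H) (m : ℕ → ℂ) (hm : ∃ C : ℝ, ∀ k, ‖m k‖ ≤ C) (k : ℕ) :
    S.diag m hm (S.e k) = m k • S.e k := by
  apply S.e.repr.injective
  ext j
  rw [repr_diag, map_smul, lp.coeFn_smul, Pi.smul_apply, smul_eq_mul, S.e.repr_self]
  rcases eq_or_ne j k with rfl | hjk
  · rfl
  · simp [hjk]

theorem diagNeg_emb_e (S : SpectralSetup H) (s : ℝ≥0) (m : ℕ → ℂ)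
    (hm : ∃ C : ℝ, ∀ k, ‖m k‖ ≤ C) (k : ℕ) :
    S.diagNeg s m hm (S.emb s (S.e k)) = m k • S.emb s (S.e k) := by
  rw [diagNeg_emb, diag_e, ← embL_apply, ← embL_apply, map_smul]

theorem topologicalClosure_span_emb_e (S : SpectralSetup H) (s : ℝ≥0) :
    (Submodule.span ℂ (Set.range fun k => S.emb s (S.e k))).topologicalClosure = ⊤ := by
  have h := DenseRange.topologicalClosure_map_submodule (f := S.embL s) (S.denseRange_emb s)
    S.e.dense_span
  have hr : (fun k => S.emb s (S.e k)) = S.embL s ∘ S.e := rfl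
  rw [hr, Set.range_comp]
  simpa [Submodule.map_span] using h

instance (S : SpectralSetup H) (s : ℝ≥0) : TopologicalSpace.SeparableSpace (S.Hneg s) := by
  rw [← TopologicalSpace.isSeparable_univ_iff]
  have h := ((Set.countable_range fun k => S.emb s (S.e k)).isSeparable.span (R := ℂ)).closure
  have h' := congrArg (fun p : Submodule ℂ (S.Hneg s) => (p : Set (S.Hneg s)))
    (S.topologicalClosure_span_emb_e s)
  simp only [Submodule.topologicalClosure_coe, Submodule.top_coe] at h'
  rwa [h'] at h

/-- Makes the Borel σ-algebra of `ℝ × H^{-s}` the product one, lets continuous maps into `H^{-s}` be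
strongly measurable, and lets characteristic functions determine measures. -/
instance (S : SpectralSetup H) (s : ℝ≥0) : SecondCountableTopology (S.Hneg s) :=
  UniformSpace.secondCountable_of_separable _

/-- Reduces any property stable under linear combinations and limits to the eigenvectors, on which
diagonal operators are scalars. -/
theorem Hneg_induction (S : SpectralSetup H) (s : ℝ≥0) (p : Submodule ℂ (S.Hneg s))
    (hp : IsClosed (p : Set (S.Hneg s))) (he : ∀ k, S.emb s (S.e k) ∈ p) (u : S.Hneg s) : u ∈ p := by
  have h : (Submodule.span ℂ (Set.range fun k => S.emb s (S.e k))).topologicalClosure ≤ p :=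
    Submodule.topologicalClosure_minimal _
      (Submodule.span_le.2 (Set.range_subset_iff.2 he)) hp
  rw [topologicalClosure_span_emb_e] at h
  exact h trivial

/-! ### The flow -/

/-- The multipliers have modulus one, so the weighted coordinates of a vector of `H` keep their
moduli; density does the rest. -/
theorem norm_flow (S : SpectralSetup H) (s : ℝ≥0) (t : ℝ) (u : S.Hneg s) :
    ‖S.flow s t u‖ = ‖u‖ := by
  refine (S.denseRange_emb s).induction_on u
    (isClosed_eq (by fun_prop) (by fun_prop)) fun x => ?_
  rw [flow, diagNeg_emb, norm_emb, norm_emb, ← S.e.repr.norm_map,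
    ← S.e.repr.norm_map (S.weight s (S.toPre s x))]
  have h : ∀ k, ‖S.e.repr (S.weight s (S.toPre s (S.diag (S.expMul t) (S.expMul_bdd t) x))) k‖ =
      ‖S.e.repr (S.weight s (S.toPre s x)) k‖ := fun k => by
    rw [repr_weight, repr_weight, LinearEquiv.symm_apply_apply, LinearEquiv.symm_apply_apply,
      repr_diag, norm_mul, norm_mul, norm_mul, expMul, ← Complex.ofReal_mul,
      Complex.norm_exp_ofReal_mul_I, one_mul]
  exact le_antisymm (lp.norm_mono (by norm_num) fun k => (h k).le)
    (lp.norm_mono (by norm_num) fun k => (h k).ge)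

theorem flow_emb_e (S : SpectralSetup H) (s : ℝ≥0) (t : ℝ) (k : ℕ) :
    S.flow s t (S.emb s (S.e k)) = S.expMul t k • S.emb s (S.e k) :=
  S.diagNeg_emb_e s _ _ k

theorem coord_flow (S : SpectralSetup H) (s : ℝ≥0) (t : ℝ) (u : S.Hneg s) (k : ℕ) :
    S.coord s (S.flow s t u) k = S.expMul t k * S.coord s u k :=
  S.coord_diagNeg s _ _ u k

theorem flow_neg_flow (S : SpectralSetup H) (s : ℝ≥0) (t : ℝ) (u : S.Hneg s) :
    S.flow s (-t) (S.flow s t u) = u := by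
  have h := S.Hneg_induction s
    (LinearMap.ker (((S.flow s (-t)).comp (S.flow s t) - ContinuousLinearMap.id ℂ _ :
      S.Hneg s →L[ℂ] S.Hneg s) : S.Hneg s →ₗ[ℂ] S.Hneg s))
    (ContinuousLinearMap.isClosed_ker _) (fun k => ?_) u
  · simpa [sub_eq_zero] using h
  · have : S.expMul t k * S.expMul (-t) k = 1 := by
      rw [expMul, expMul, ← Complex.exp_add]; simp
    simp [flow_emb_e, smul_smul, this]

theorem flow_flow_neg (S : SpectralSetup H) (s : ℝ≥0) (t : ℝ) (u : S.Hneg s) :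
    S.flow s t (S.flow s (-t) u) = u := by
  simpa using S.flow_neg_flow s (-t) u

/-- The flow at time `t` as a homeomorphism. -/
def flowHomeo (S : SpectralSetup H) (s : ℝ≥0) (t : ℝ) : S.Hneg s ≃ₜ S.Hneg s where
  toFun := S.flow s t
  invFun := S.flow s (-t)
  left_inv := S.flow_neg_flow s t
  right_inv := S.flow_flow_neg s t
  continuous_toFun := (S.flow s t).continuous
  continuous_invFun := (S.flow s (-t)).continuous

theorem measurableEmbedding_flow (S : SpectralSetup H) (s : ℝ≥0) (t : ℝ) :
    MeasurableEmbedding (S.flow s t) :=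
  (S.flowHomeo s t).measurableEmbedding

/-- On `eₖ` the orbit is an explicit exponential. Vectors with continuous orbit form a closed
subspace: since the flow is isometric, approximating `u` approximates its orbit uniformly in time.
-/
theorem continuous_flow (S : SpectralSetup H) (s : ℝ≥0) (u : S.Hneg s) :
    Continuous fun t => S.flow s t u := by
  let p : Submodule ℂ (S.Hneg s) :=
    { carrier := {u | Continuous fun t => S.flow s t u}
      add_mem' := fun {a b} ha hb => by
        change Continuous fun t => S.flow s t (a + b)
        simp only [map_add]
        exact Continuous.add ha hb
      zero_mem' := by simpa using continuous_const
      smul_mem' := fun c a ha => by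
        change Continuous fun t => S.flow s t (c • a)
        simp only [map_smul]
        exact Continuous.const_smul ha c }
  refine S.Hneg_induction s p ?_ (fun k => ?_) u
  · rw [← closure_subset_iff_isClosed]
    intro u hu
    refine continuous_of_uniform_approx_of_continuous fun v hv => ?_
    obtain ⟨ε, hε, h⟩ := Metric.mem_uniformity_dist.1 hv
    obtain ⟨w, hw, hd⟩ := Metric.mem_closure_iff.1 hu ε hε
    refine ⟨fun t => S.flow s t w, hw, fun t => h ?_⟩
    rwa [dist_eq_norm, ← map_sub, norm_flow, ← dist_eq_norm]
  · change Continuous fun t => S.flow s t (S.emb s (S.e k))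
    simp only [flow_emb_e, expMul]
    fun_prop

/-! ### Gradients of cylindrical functions -/

theorem inner_e_cylGrad (S : SpectralSetup H) (s : ℝ≥0) {n : ℕ} (φ : (Fin n → ℂ) → ℝ)
    (u : S.Hneg s) (j : ℕ) :
    inner ℂ (S.e j) (S.cylGrad s φ u) = if hj : j < n then
      ((fderiv ℝ φ (fun j => S.coord s u j) (Pi.single ⟨j, hj⟩ 1) : ℝ) : ℂ) +
        ((fderiv ℝ φ (fun j => S.coord s u j) (Pi.single ⟨j, hj⟩ I) : ℝ) : ℂ) * I else 0 := by
  simp only [cylGrad, inner_sum, inner_add_right, inner_smul_right,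
    orthonormal_iff_ite.1 S.e.orthonormal]
  split_ifs with hj
  · rw [Finset.sum_eq_single ⟨j, hj⟩]
    · simp
    · intro b _ hb
      have : j ≠ b := fun h => hb (Fin.ext h.symm)
      simp [this]
    · simp
  · refine Finset.sum_eq_zero fun b _ => ?_
    have : j ≠ b := fun h => hj (h ▸ b.2)
    simp [this]

theorem linear_eq_sum_single {n : ℕ} (L : (Fin n → ℂ) →L[ℝ] ℝ) (a : Fin n → ℂ) :
    L a = ∑ k, ((a k).re * L (Pi.single k 1) + (a k).im * L (Pi.single k I)) := by
  have h : a = ∑ k, ((a k).re • (Pi.single k 1 : Fin n → ℂ) +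
      (a k).im • (Pi.single k I : Fin n → ℂ)) := by
    funext j
    simp only [Finset.sum_apply, Pi.add_apply, Pi.smul_apply]
    rw [Finset.sum_eq_single j]
    · simp
    · intro b _ hb
      simp [Pi.single_eq_of_ne hb.symm]
    · simp
  conv_lhs => rw [h]
  simp

/-- The bridge to finite-dimensional calculus: the gradient has no coordinates beyond `n`, so the
series is a finite sum, and this sum is a directional derivative of `φ`. -/
theorem pairing_cylGrad (S : SpectralSetup H) (s : ℝ≥0) {n : ℕ} (φ : (Fin n → ℂ) → ℝ)
    (u : S.Hneg s) (a : ℕ → ℂ) :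
    S.pairing a (S.cylGrad s φ u) = fderiv ℝ φ (fun j => S.coord s u j) (fun j => a j) := by
  rw [pairing, tsum_eq_sum (s := Finset.range n), linear_eq_sum_single, Finset.sum_range]
  · refine Finset.sum_congr rfl fun k _ => ?_
    rw [inner_e_cylGrad, dif_pos k.2]
    simp
    ring
  · intro j hj
    rw [inner_e_cylGrad, dif_neg (by simpa using hj)]
    simp

end SpectralSetup

end

noncomputable section

open ProbabilityTheory

/-! ### Gaussian integration by parts on the real line -/

theorem hasDerivAt_gaussianPDFReal (v : ℝ≥0) (x : ℝ) :
    HasDerivAt (gaussianPDFReal 0 v) (-(v : ℝ)⁻¹ * (x * gaussianPDFReal 0 v x)) x := by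
  have h1 : HasDerivAt (fun x : ℝ => -(x - 0) ^ 2 / (2 * (v : ℝ))) (-(2 * x) / (2 * (v : ℝ))) x := by
    have := (((hasDerivAt_id x).sub_const 0).pow 2).neg.div_const (2 * (v : ℝ))
    simpa using this
  have h2 := (h1.exp).const_mul ((√(2 * Real.pi * v))⁻¹)
  rw [gaussianPDFReal_def]
  refine h2.congr_deriv ?_
  have h3 : -(2 * x) / (2 * (v : ℝ)) = -(v : ℝ)⁻¹ * x := by
    rw [neg_div, mul_div_mul_left _ _ two_ne_zero, div_eq_mul_inv]
    ring
  rw [h3]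
  ring

/-- The density `p` satisfies `p' = -x p / v`. Boundedness of `f` and `f'` makes all products
integrable, so no boundary terms appear. -/
theorem integral_deriv_gaussianReal {v : ℝ≥0} (hv : v ≠ 0) {f f' : ℝ → ℝ} {C : ℝ}
    (hf : ∀ x, HasDerivAt f (f' x) x) (hfC : ∀ x, ‖f x‖ ≤ C) (hf' : Measurable f')
    (hfC' : ∀ x, ‖f' x‖ ≤ C) :
    ∫ x, f' x ∂(gaussianReal 0 v) = (v : ℝ)⁻¹ * ∫ x, x * f x ∂(gaussianReal 0 v) := by
  have hfm : Measurable f :=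
    (continuous_iff_continuousAt.2 fun x => (hf x).continuousAt).measurable
  have hid : Integrable (fun x : ℝ => gaussianPDFReal 0 v x * x) := by
    have h1 : Integrable id (gaussianReal 0 v) := (memLp_id_gaussianReal 1).integrable (by norm_num)
    rw [gaussianReal_of_var_ne_zero _ hv] at h1
    rw [integrable_withDensity_iff_integrable_smul₀' (measurable_gaussianPDF 0 v).aemeasurable
      (ae_of_all _ fun x => by simp [gaussianPDF])] at h1
    simpa [toReal_gaussianPDF] using h1
  have hg := integrable_gaussianPDFReal 0 v
  have key := integral_mul_deriv_eq_deriv_mul_of_integrable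
    (u := f) (u' := f') (v := gaussianPDFReal 0 v)
    (v' := fun x => -(v : ℝ)⁻¹ * (x * gaussianPDFReal 0 v x))
    (fun x _ => hf x) (fun x _ => hasDerivAt_gaussianPDFReal v x)
    (((hid.bdd_mul hfm.aestronglyMeasurable (ae_of_all _ hfC)).const_mul (-(v : ℝ)⁻¹)).congr
      (ae_of_all _ fun x => by simp only [Pi.mul_apply]; ring))
    (hg.bdd_mul hf'.aestronglyMeasurable (ae_of_all _ hfC'))
    (hg.bdd_mul hfm.aestronglyMeasurable (ae_of_all _ hfC))
  rw [integral_gaussianReal_eq_integral_smul hv, integral_gaussianReal_eq_integral_smul hv,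
    ← integral_const_mul]
  simp only [smul_eq_mul]
  calc ∫ x, gaussianPDFReal 0 v x * f' x = ∫ x, f' x * gaussianPDFReal 0 v x := by
        simp only [mul_comm]
    _ = -∫ x, f x * (-(v : ℝ)⁻¹ * (x * gaussianPDFReal 0 v x)) := by rw [key, neg_neg]
    _ = _ := by
        rw [← integral_neg]
        congr 1
        funext x
        ring

namespace SpectralSetup

variable {H : Type*} [NormedAddCommGroup H] [InnerProductSpace ℂ H] [CompleteSpace H]

/-! ### Disintegration of the Gaussian measure along an eigendirection -/

/-- The direction `c eₖ` in `H^{-s}`. -/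
def dir (S : SpectralSetup H) (s : ℝ≥0) (k : ℕ) (c : ℂ) : S.Hneg s := c • S.emb s (S.e k)

/-- The real coordinate `⟨u, c eₖ⟩`. -/
def rcoord (S : SpectralSetup H) (s : ℝ≥0) (k : ℕ) (c : ℂ) (u : S.Hneg s) : ℝ :=
  (conj c * S.coord s u k).re

@[fun_prop]
theorem continuous_coord (S : SpectralSetup H) (s : ℝ≥0) (k : ℕ) :
    Continuous fun u : S.Hneg s => S.coord s u k := (S.coordL s k).continuous

@[fun_prop]
theorem continuous_rcoord (S : SpectralSetup H) (s : ℝ≥0) (k : ℕ) (c : ℂ) :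
    Continuous (S.rcoord s k c) := by
  unfold rcoord
  fun_prop

theorem coord_add (S : SpectralSetup H) (s : ℝ≥0) (k : ℕ) (u v : S.Hneg s) :
    S.coord s (u + v) k = S.coord s u k + S.coord s v k := (S.coordL s k).map_add u v

theorem coord_smul (S : SpectralSetup H) (s : ℝ≥0) (k : ℕ) (a : ℂ) (u : S.Hneg s) :
    S.coord s (a • u) k = a * S.coord s u k := (S.coordL s k).map_smul a u

theorem coord_dir (S : SpectralSetup H) (s : ℝ≥0) (k j : ℕ) (c : ℂ) :
    S.coord s (S.dir s k c) j = if j = k then c else 0 := by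
  rw [dir, coord_smul, coord_emb_e]
  simp

theorem rcoord_add_smul_dir (S : SpectralSetup H) (s : ℝ≥0) (k : ℕ) {c : ℂ} (hc : ‖c‖ = 1)
    (r : ℝ) (u : S.Hneg s) :
    S.rcoord s k c (u + (r : ℂ) • S.dir s k c) = S.rcoord s k c u + r := by
  have h : conj c * c = 1 := by
    rw [← Complex.normSq_eq_conj_mul_self, Complex.normSq_eq_norm_sq, hc]; simp
  have h2 : conj c * (S.coord s u k + r * c) = conj c * S.coord s u k + r := by
    linear_combination (r : ℂ) * h
  rw [rcoord, coord_add, coord_smul, coord_dir, if_pos rfl, h2, rcoord]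
  simp

/-- The component of `u` orthogonal to `c eₖ`. -/
def proj (S : SpectralSetup H) (s : ℝ≥0) (k : ℕ) (c : ℂ) (u : S.Hneg s) : S.Hneg s :=
  u - (S.rcoord s k c u : ℂ) • S.dir s k c

@[fun_prop]
theorem continuous_proj (S : SpectralSetup H) (s : ℝ≥0) (k : ℕ) (c : ℂ) :
    Continuous (S.proj s k c) := by
  unfold proj
  fun_prop

theorem rcoord_proj (S : SpectralSetup H) (s : ℝ≥0) (k : ℕ) {c : ℂ} (hc : ‖c‖ = 1)
    (u : S.Hneg s) : S.rcoord s k c (S.proj s k c u) = 0 := by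
  have h := S.rcoord_add_smul_dir s k hc (-S.rcoord s k c u) u
  rw [add_neg_cancel] at h
  rw [← h, proj, sub_eq_add_neg]
  simp

/-- The variance `1 / λₖ` of the real coordinates. -/
def var (S : SpectralSetup H) (k : ℕ) : ℝ≥0 := ⟨(S.lam k)⁻¹, (inv_pos.2 (S.lam_pos k)).le⟩

theorem var_ne_zero (S : SpectralSetup H) (k : ℕ) : S.var k ≠ 0 := fun h =>
  (inv_pos.2 (S.lam_pos k)).ne' (congrArg NNReal.toReal h)

theorem coe_var_inv (S : SpectralSetup H) (k : ℕ) : (S.var k : ℝ)⁻¹ = S.lam k := inv_inv _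

/-- The inner product of `H^{-s}` carries the weight `λₖ^{-s}` along `eₖ`; the factor `λₖ^s` undoes
it and leaves the duality pairing. -/
theorem re_inner_dir (S : SpectralSetup H) (s : ℝ≥0) (k : ℕ) (c : ℂ) (u : S.Hneg s) :
    (S.lam k ^ (s : ℝ)) * (inner ℂ (S.dir s k c) u).re = S.rcoord s k c u := by
  rw [rcoord, coord, dir, inner_smul_left, mul_left_comm, Complex.re_ofReal_mul]

theorem inner_re_comm (S : SpectralSetup H) (s : ℝ≥0) (u v : S.Hneg s) :
    (inner ℂ u v).re = (inner ℂ v u).re := by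
  rw [← inner_conj_symm, Complex.conj_re]

/-- The covariance form of the Gaussian measure. -/
theorem covariance_sub_smul_dir (S : SpectralSetup H) (s : ℝ≥0) (k : ℕ) {c : ℂ} (hc : ‖c‖ = 1)
    (ξ : S.Hneg s) :
    let a := (inner ℂ (S.dir s k c) ξ).re
    let η := ξ - ((a * S.lam k ^ (s : ℝ) : ℝ) : ℂ) • S.dir s k c
    (inner ℂ η (S.powNeg s (s + 1) η)).re + a ^ 2 * (S.lam k)⁻¹ =
      (inner ℂ ξ (S.powNeg s (s + 1) ξ)).re := by
  intro a η
  set d := S.dir s k c with hd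
  set L := S.lam k ^ (s : ℝ) with hL
  set P := S.powNeg s (s + 1) with hP
  have hLpos : 0 < L := Real.rpow_pos_of_pos (S.lam_pos k) _
  have hm : S.negPow (s + 1) k = ((L⁻¹ * (S.lam k)⁻¹ : ℝ) : ℂ) := by
    rw [negPow, hL, ← Real.rpow_neg (S.lam_pos k).le, ← Real.rpow_neg_one, ← Real.rpow_add (S.lam_pos k)]
    congr 2
    push_cast
    ring
  have h1 : P d = ((L⁻¹ * (S.lam k)⁻¹ : ℝ) : ℂ) • d := by
    rw [hP, powNeg, hd, dir, map_smul, diagNeg_emb_e, hm, smul_comm]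
  have h2 : (inner ℂ d (P ξ)).re = (L⁻¹ * (S.lam k)⁻¹) * a := by
    have e1 := S.re_inner_dir s k c (P ξ)
    have e2 := S.re_inner_dir s k c ξ
    rw [rcoord] at e1 e2
    rw [hP, powNeg, coord_diagNeg, hm, mul_left_comm, Complex.re_ofReal_mul, ← e2] at e1
    exact mul_left_cancel₀ hLpos.ne' (e1.trans (by ring))
  have h3 : (inner ℂ ξ d).re = a := S.inner_re_comm s _ _
  have h4 : (inner ℂ d d).re = L⁻¹ := by
    have e1 := S.re_inner_dir s k c d
    have e2 := S.rcoord_add_smul_dir s k hc 1 0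
    have e3 : S.rcoord s k c 0 = 0 := by simp [rcoord, ← coordL_apply]
    rw [e3] at e2
    simp only [Complex.ofReal_one, one_smul, zero_add] at e2
    rw [e2] at e1
    exact eq_inv_of_mul_eq_one_right e1
  -- Both cross terms and the square term equal `a² / λₖ` in absolute value, for a net `-a² / λₖ`.
  have h5 : (inner ℂ η (P η)).re = (inner ℂ ξ (P ξ)).re - (a * L) * (L⁻¹ * (S.lam k)⁻¹ * a)
      - (a * L) * (L⁻¹ * (S.lam k)⁻¹ * a) + (a * L) * (a * L) * (L⁻¹ * (S.lam k)⁻¹ * L⁻¹) := by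
    simp only [η, ← hd, ← hL, map_sub, map_smul, inner_sub_left, inner_sub_right, inner_smul_left,
      inner_smul_right, h1, Complex.conj_ofReal, Complex.sub_re, Complex.re_ofReal_mul, h2, h3, h4]
    ring
  rw [h5]
  field_simp
  ring

/-- The direction `c eₖ` diagonalises the covariance, so the coordinate along it is independent of
the orthogonal component, and replacing it by an independent Gaussian of variance `1 / λₖ` preserves
the law. In terms of characteristic functions, the exponents agree by `covariance_sub_smul_dir`. -/
theorem IsGaussian.eq_map_prod {S : SpectralSetup H} {s : ℝ≥0} {ν : Measure (S.Hneg s)}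
    (hν : S.IsGaussian s ν) (k : ℕ) {c : ℂ} (hc : ‖c‖ = 1) :
    ν = ((gaussianReal 0 (S.var k)).prod ν).map
      fun p => S.proj s k c p.2 + (p.1 : ℂ) • S.dir s k c := by
  have := hν.1
  let _ : InnerProductSpace ℝ (S.Hneg s) := InnerProductSpace.rclikeToReal ℂ (S.Hneg s)
  have hcont : Continuous fun p : ℝ × S.Hneg s =>
      S.proj s k c p.2 + (p.1 : ℂ) • S.dir s k c := by fun_prop
  have : IsProbabilityMeasure (((gaussianReal 0 (S.var k)).prod ν).map
      fun p => S.proj s k c p.2 + (p.1 : ℂ) • S.dir s k c) :=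
    Measure.isProbabilityMeasure_map hcont.aemeasurable
  have hchar : ∀ ξ, charFun ν ξ =
      Complex.exp (-(1 / 2) * ((inner ℂ ξ (S.powNeg s (s + 1) ξ)).re : ℂ)) := fun ξ => by
    rw [← hν.2 ξ, charFun_apply]
    refine integral_congr_ae (ae_of_all _ fun u => ?_)
    change Complex.exp (((inner ℂ u ξ).re : ℂ) * I) = _
    rw [mul_comm]
  refine Measure.ext_of_charFun ?_
  funext ξ
  set a := (inner ℂ (S.dir s k c) ξ).re with ha
  set η := ξ - ((a * S.lam k ^ (s : ℝ) : ℝ) : ℂ) • S.dir s k c with hη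
  have hcov := S.covariance_sub_smul_dir s k hc ξ
  simp only at hcov
  rw [← ha, ← hη] at hcov
  rw [charFun_apply, charFun_apply, integral_map hcont.aemeasurable (by fun_prop)]
  -- The projection is symmetric for the real inner product, so it can be moved onto `ξ`, where it
  -- yields `η`; the new coordinate contributes `a * p.1`.
  have hint : ∀ p : ℝ × S.Hneg s, Complex.exp
      ((inner ℝ (S.proj s k c p.2 + (p.1 : ℂ) • S.dir s k c) ξ : ℝ) * I) =
      Complex.exp (a * p.1 * I) * Complex.exp ((inner ℝ p.2 η : ℝ) * I) := fun p => by
    rw [← Complex.exp_add, ← add_mul]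
    congr 2
    change (((inner ℂ _ ξ).re : ℝ) : ℂ) = a * p.1 + (((inner ℂ p.2 η).re : ℝ) : ℂ)
    have e1 := S.re_inner_dir s k c p.2
    rw [S.inner_re_comm] at e1
    rw [hη, proj, inner_add_left, inner_sub_left, inner_smul_left, inner_smul_left,
      inner_sub_right, inner_smul_right, Complex.conj_ofReal, Complex.conj_ofReal, Complex.add_re,
      Complex.sub_re, Complex.sub_re, Complex.re_ofReal_mul, Complex.re_ofReal_mul,
      Complex.re_ofReal_mul, ← ha, ← e1]
    push_cast
    ring
  simp only [hint]
  rw [integral_prod_mul (fun r : ℝ => Complex.exp (a * r * I))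
    (fun u : S.Hneg s => Complex.exp ((inner ℝ u η : ℝ) * I)), ← charFun_apply_real,
    ← charFun_apply, ← charFun_apply, charFun_gaussianReal, hchar, hchar, ← Complex.exp_add, ← hcov]
  congr 1
  have hv : ((S.var k : ℝ) : ℂ) = (S.lam k : ℂ)⁻¹ := Complex.ofReal_inv _
  rw [hv]
  push_cast
  ring

theorem IsGaussian.map_rcoord {S : SpectralSetup H} {s : ℝ≥0} {ν : Measure (S.Hneg s)}
    (hν : S.IsGaussian s ν) (k : ℕ) {c : ℂ} (hc : ‖c‖ = 1) :
    ν.map (S.rcoord s k c) = gaussianReal 0 (S.var k) := by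
  have := hν.1
  rw [hν.eq_map_prod k hc, Measure.map_map (by fun_prop) (by fun_prop)]
  have h : (S.rcoord s k c ∘ fun p : ℝ × S.Hneg s =>
      S.proj s k c p.2 + (p.1 : ℂ) • S.dir s k c) = Prod.fst := by
    funext p
    rw [Function.comp_apply, rcoord_add_smul_dir _ _ _ hc, rcoord_proj _ _ _ hc, zero_add]
  rw [h, Measure.map_fst_prod]
  simp

theorem IsGaussian.memLp_rcoord {S : SpectralSetup H} {s : ℝ≥0} {ν : Measure (S.Hneg s)}
    (hν : S.IsGaussian s ν) (k : ℕ) {c : ℂ} (hc : ‖c‖ = 1) :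
    MemLp (S.rcoord s k c) 2 ν := by
  have h := memLp_id_gaussianReal (μ := 0) (v := S.var k) 2
  rw [← hν.map_rcoord k hc] at h
  exact (memLp_map_measure_iff (f := S.rcoord s k c) (g := id) (by fun_prop) (by fun_prop)).1 h

theorem IsGaussian.memLp_coord {S : SpectralSetup H} {s : ℝ≥0} {ν : Measure (S.Hneg s)}
    (hν : S.IsGaussian s ν) (k : ℕ) : MemLp (fun u => S.coord s u k) 2 ν := by
  have h1 := (hν.memLp_rcoord k (c := 1) (by simp)).norm
  have h2 := (hν.memLp_rcoord k (c := I) (by simp)).norm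
  refine (h1.add h2).mono (by fun_prop) (ae_of_all _ fun u => ?_)
  refine (Complex.norm_le_abs_re_add_abs_im _).trans ((le_of_eq ?_).trans (le_abs_self _))
  simp [rcoord]

/-- Gaussian integration by parts in the direction `c eₖ`. -/
theorem IsGaussian.integral_deriv {S : SpectralSetup H} {s : ℝ≥0} {ν : Measure (S.Hneg s)}
    (hν : S.IsGaussian s ν) (k : ℕ) {c : ℂ} (hc : ‖c‖ = 1) {f f' : S.Hneg s → ℝ} {C : ℝ}
    (hf : ∀ u, HasDerivAt (fun r : ℝ => f (u + (r : ℂ) • S.dir s k c)) (f' u) 0)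
    (hfm : Measurable f) (hfm' : Measurable f') (hfC : ∀ u, ‖f u‖ ≤ C) (hfC' : ∀ u, ‖f' u‖ ≤ C) :
    ∫ u, f' u ∂ν = S.lam k * ∫ u, S.rcoord s k c u * f u ∂ν := by
  have := hν.1
  have hmeas : Measurable fun p : ℝ × S.Hneg s =>
      S.proj s k c p.2 + (p.1 : ℂ) • S.dir s k c := by fun_prop
  have hf1 : Integrable f' ν :=
    (integrable_const C).mono' hfm'.aestronglyMeasurable (ae_of_all _ hfC')
  have hf2 : Integrable (fun u => S.rcoord s k c u * f u) ν :=
    ((hν.memLp_rcoord k hc).integrable (by norm_num)).mul_bdd (c := C) hfm.aestronglyMeasurable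
      (ae_of_all _ hfC)
  -- Translating the base point turns derivatives at `0` from every `u` into derivatives along a
  -- whole line.
  have hder : ∀ (w : S.Hneg s) (x : ℝ), HasDerivAt (fun r : ℝ => f (w + (r : ℂ) • S.dir s k c))
      (f' (w + (x : ℂ) • S.dir s k c)) x := fun w x => by
    have h := hf (w + (x : ℂ) • S.dir s k c)
    have h2 := HasDerivAt.comp_sub_const x x (by rwa [sub_self])
    refine h2.congr_of_eventuallyEq (Eventually.of_forall fun r => ?_)
    change _ = f _
    rw [Complex.ofReal_sub, sub_smul, add_add_sub_cancel]
  have key : ∀ w, ∫ r, f' (S.proj s k c w + (r : ℂ) • S.dir s k c) ∂(gaussianReal 0 (S.var k)) =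
      S.lam k * ∫ r, S.rcoord s k c (S.proj s k c w + (r : ℂ) • S.dir s k c) *
        f (S.proj s k c w + (r : ℂ) • S.dir s k c) ∂(gaussianReal 0 (S.var k)) := fun w => by
    rw [integral_deriv_gaussianReal (S.var_ne_zero k) (C := C) (hder _) (fun x => hfC _)
      (by fun_prop) (fun x => hfC' _), coe_var_inv]
    simp only [rcoord_add_smul_dir _ _ _ hc, rcoord_proj _ _ _ hc, zero_add]
  have hmap := hν.eq_map_prod k hc
  have hmp : MeasurePreserving (fun p : ℝ × S.Hneg s =>
      S.proj s k c p.2 + (p.1 : ℂ) • S.dir s k c) ((gaussianReal 0 (S.var k)).prod ν) ν :=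
    ⟨hmeas, hmap.symm⟩
  have hint : ∀ g : S.Hneg s → ℝ, AEStronglyMeasurable g ν → ∫ u, g u ∂ν =
      ∫ p, g (S.proj s k c p.2 + ((p.1 : ℝ) : ℂ) • S.dir s k c)
        ∂((gaussianReal 0 (S.var k)).prod ν) := fun g hg => by
    rw [← hmp.map_eq] at hg
    rw [← integral_map hmeas.aemeasurable hg, hmp.map_eq]
  rw [hint _ hf1.aestronglyMeasurable, hint _ hf2.aestronglyMeasurable,
    integral_prod_symm (fun p : ℝ × S.Hneg s => f' (S.proj s k c p.2 + (p.1 : ℂ) • S.dir s k c))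
      (hmp.integrable_comp_of_integrable hf1),
    integral_prod_symm (fun p : ℝ × S.Hneg s =>
      S.rcoord s k c (S.proj s k c p.2 + (p.1 : ℂ) • S.dir s k c) *
        f (S.proj s k c p.2 + (p.1 : ℂ) • S.dir s k c))
      (hmp.integrable_comp_of_integrable hf2), ← integral_const_mul]
  exact integral_congr_ae (ae_of_all _ key)

/-! ### Integration by parts in the Gross-Sobolev space -/

theorem pairing_coord_dir (S : SpectralSetup H) (s : ℝ≥0) (k : ℕ) (c : ℂ) (x : H) :
    S.pairing (S.coord s (S.dir s k c)) x = S.rcoord s k c (S.emb s x) := by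
  rw [pairing, tsum_eq_single k fun j hj => by rw [coord_dir, if_neg hj]; simp, coord_dir,
    if_pos rfl, rcoord, coord_emb]
  simp only [Complex.mul_re, Complex.conj_re, Complex.conj_im]
  ring

theorem hasDerivAt_comp_coord (S : SpectralSetup H) (s : ℝ≥0) {n : ℕ} {P : (Fin n → ℂ) → ℝ}
    (hP : Differentiable ℝ P) (k : ℕ) (c : ℂ) (u : S.Hneg s) :
    HasDerivAt (fun r : ℝ => P fun j => S.coord s (u + (r : ℂ) • S.dir s k c) j)
      (fderiv ℝ P (fun j => S.coord s u j) fun j => S.coord s (S.dir s k c) j) 0 := by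
  have h1 : HasDerivAt (fun (r : ℝ) (j : Fin n) => S.coord s (u + (r : ℂ) • S.dir s k c) j)
      (fun j => S.coord s (S.dir s k c) j) 0 := by
    rw [hasDerivAt_pi]
    intro j
    simp only [coord_add, coord_smul]
    have := ((Complex.ofRealCLM.hasDerivAt (x := (0 : ℝ))).mul_const
      (S.coord s (S.dir s k c) j)).const_add (S.coord s u j)
    simpa using this
  have h2 := (hP fun j => S.coord s (u + ((0 : ℝ) : ℂ) • S.dir s k c) j).hasFDerivAt
  have h3 := h2.comp_hasDerivAt (0 : ℝ) h1
  simpa [Function.comp_def] using h3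

theorem IsCbInfty.differentiable {n : ℕ} {φ : (Fin n → ℂ) → ℝ} (hφ : IsCbInfty φ) :
    Differentiable ℝ φ := hφ.1.differentiable (by simp)

theorem IsCbInfty.continuous_fderiv {n : ℕ} {φ : (Fin n → ℂ) → ℝ} (hφ : IsCbInfty φ) :
    Continuous (fderiv ℝ φ) := hφ.1.continuous_fderiv (by simp)

theorem IsCbInfty.bounded {n : ℕ} {φ : (Fin n → ℂ) → ℝ} (hφ : IsCbInfty φ) :
    ∃ C, ∀ z, ‖φ z‖ ≤ C := by
  obtain ⟨C, hC⟩ := hφ.2 0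
  exact ⟨C, fun z => by simpa using hC z⟩

theorem IsCbInfty.fderiv_bounded {n : ℕ} {φ : (Fin n → ℂ) → ℝ} (hφ : IsCbInfty φ) :
    ∃ C, ∀ z, ‖fderiv ℝ φ z‖ ≤ C := by
  obtain ⟨C, hC⟩ := hφ.2 1
  exact ⟨C, fun z => by simpa using hC z⟩

theorem rcoord_cylGrad (S : SpectralSetup H) (s : ℝ≥0) {n : ℕ} (φ : (Fin n → ℂ) → ℝ) (k : ℕ)
    (c : ℂ) (u : S.Hneg s) : S.rcoord s k c (S.emb s (S.cylGrad s φ u)) =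
      fderiv ℝ φ (fun j => S.coord s u j) fun j => S.coord s (S.dir s k c) j := by
  rw [← pairing_coord_dir, pairing_cylGrad]

theorem norm_rcoord_le (S : SpectralSetup H) (s : ℝ≥0) (k : ℕ) {c : ℂ} (hc : ‖c‖ = 1)
    (u : S.Hneg s) : ‖S.rcoord s k c u‖ ≤ ‖S.coordL s k‖ * ‖u‖ := by
  refine (Complex.abs_re_le_norm _).trans ?_
  rw [norm_mul, Complex.norm_conj, hc, one_mul]
  exact (S.coordL s k).le_opNorm u

theorem rcoord_sub (S : SpectralSetup H) (s : ℝ≥0) (k : ℕ) (c : ℂ) (u v : S.Hneg s) :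
    S.rcoord s k c (u - v) = S.rcoord s k c u - S.rcoord s k c v := by
  simp only [rcoord, ← coordL_apply, map_sub, mul_sub, Complex.sub_re]

theorem memLp_rcoord_comp (S : SpectralSetup H) (s : ℝ≥0) (k : ℕ) {c : ℂ} (hc : ‖c‖ = 1)
    {ν : Measure (S.Hneg s)} {g : S.Hneg s → S.Hneg s} (hg : MemLp g 2 ν) :
    MemLp (fun u => S.rcoord s k c (g u)) 2 ν :=
  hg.of_le_mul ((S.continuous_rcoord s k c).comp_aestronglyMeasurable hg.1)
    (ae_of_all _ fun u => S.norm_rcoord_le s k hc (g u))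

/-- For cylindrical `F_j → h` the product `G ψ(F_j)` is bounded with bounded directional derivative,
so the Gaussian formula applies. In the limit, `ψ(F_j)` and `ψ'(F_j)` converge only almost
everywhere along a subsequence, while the gradients converge in `L²`; the two limits are therefore
taken separately. -/
theorem integral_deriv_mul_comp {S : SpectralSetup H} {s : ℝ≥0} {ν : Measure (S.Hneg s)}
    (hν : S.IsGaussian s ν) {h : S.Hneg s → ℝ} {g : S.Hneg s → S.Hneg s}
    (hh : S.IsMalliavinDeriv s ν h g) (k : ℕ) {c : ℂ} (hc : ‖c‖ = 1)
    {G G' : S.Hneg s → ℝ} {C : ℝ}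
    (hG : ∀ u, HasDerivAt (fun r : ℝ => G (u + (r : ℂ) • S.dir s k c)) (G' u) 0)
    (hGm : Continuous G) (hGm' : Continuous G') (hGC : ∀ u, ‖G u‖ ≤ C) (hGC' : ∀ u, ‖G' u‖ ≤ C)
    {ψ ψ' : ℝ → ℝ} {B : ℝ} (hψ : ∀ x, HasDerivAt ψ (ψ' x) x) (hψ' : Continuous ψ')
    (hψB : ∀ x, ‖ψ x‖ ≤ B) (hψB' : ∀ x, ‖ψ' x‖ ≤ B) :
    ∫ u, (G' u * ψ (h u) + G u * ψ' (h u) * S.rcoord s k c (g u)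
      - S.lam k * (S.rcoord s k c u * (G u * ψ (h u)))) ∂ν = 0 := by
  have := hν.1
  obtain ⟨hh2, hg2, n, φ, hφ, hlim, hlim'⟩ := hh
  have hψc : Continuous ψ := continuous_iff_continuousAt.2 fun x => (hψ x).continuousAt
  have hC0 : 0 ≤ C := (norm_nonneg _).trans (hGC 0)
  have hB0 : 0 ≤ B := (norm_nonneg _).trans (hψB 0)
  have hcyl : ∀ j, Continuous (S.cyl s (φ j)) := fun j => by
    unfold cyl
    exact (hφ j).1.continuous.comp (by fun_prop)
  let D : ℕ → S.Hneg s → ℝ := fun j u => S.rcoord s k c (S.emb s (S.cylGrad s (φ j) u))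
  have hD : ∀ j, Continuous (D j) := fun j => by
    simp only [D, rcoord_cylGrad]
    exact ((hφ j).continuous_fderiv.comp
      (by fun_prop : Continuous fun (u : S.Hneg s) (i : Fin (n j)) => S.coord s u i)).clm_apply
      continuous_const
  have hDB : ∀ j, ∃ M, ∀ u, ‖D j u‖ ≤ M := fun j => by
    obtain ⟨M, hM⟩ := (hφ j).fderiv_bounded
    refine ⟨M * ‖fun i : Fin (n j) => S.coord s (S.dir s k c) i‖, fun u => ?_⟩
    simp only [D, rcoord_cylGrad]
    exact (ContinuousLinearMap.le_opNorm _ _).trans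
      (mul_le_mul_of_nonneg_right (hM _) (norm_nonneg _))
  have hx := hν.memLp_rcoord k hc
  have hxi : Integrable (S.rcoord s k c) ν := hx.integrable (by norm_num)
  have hgx := S.memLp_rcoord_comp s k hc hg2
  have hgxi : Integrable (fun u => S.rcoord s k c (g u)) ν := hgx.integrable (by norm_num)
  have hψh : ∀ j, Continuous fun u => ψ (S.cyl s (φ j) u) := fun j => hψc.comp (hcyl j)
  have hψh' : ∀ j, Continuous fun u => ψ' (S.cyl s (φ j) u) := fun j => hψ'.comp (hcyl j)
  -- integration by parts for the approximations
  have key : ∀ j, ∫ u, (G' u * ψ (S.cyl s (φ j) u) + G u * ψ' (S.cyl s (φ j) u) * D j u) ∂ν =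
      S.lam k * ∫ u, S.rcoord s k c u * (G u * ψ (S.cyl s (φ j) u)) ∂ν := fun j => by
    obtain ⟨M, hM⟩ := hDB j
    have hM0 : 0 ≤ M := (norm_nonneg _).trans (hM 0)
    refine hν.integral_deriv k hc (C := C * B + C * B * M) (fun u => ?_)
      (hGm.mul (hψh j)).measurable
      ((hGm'.mul (hψh j)).add ((hGm.mul (hψh' j)).mul (hD j))).measurable
      (fun u => ?_) fun u => ?_
    · have h1 := S.hasDerivAt_comp_coord s (hφ j).differentiable k c u
      rw [← rcoord_cylGrad] at h1
      have h2 : HasDerivAt (fun r : ℝ => ψ (S.cyl s (φ j) (u + (r : ℂ) • S.dir s k c)))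
          (ψ' (S.cyl s (φ j) u) * D j u) 0 := by
        have h3 := hψ (S.cyl s (φ j) (u + ((0 : ℝ) : ℂ) • S.dir s k c))
        have h4 := h3.comp (0 : ℝ) h1
        simpa [Function.comp_def, cyl, D] using h4
      have h5 := (hG u).mul h2
      refine h5.congr_deriv ?_
      simp only [Complex.ofReal_zero, zero_smul, add_zero]
      ring
    · rw [norm_mul]
      exact (mul_le_mul (hGC u) (hψB _) (norm_nonneg _) hC0).trans
        (le_add_of_nonneg_right (by positivity))
    · refine (norm_add_le _ _).trans (add_le_add ?_ ?_)
      · rw [norm_mul]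
        exact mul_le_mul (hGC' u) (hψB _) (norm_nonneg _) hC0
      · rw [norm_mul, norm_mul]
        exact mul_le_mul (mul_le_mul (hGC u) (hψB' _) (norm_nonneg _) hC0) (hM u)
          (norm_nonneg _) (by positivity)
  -- an almost everywhere convergent subsequence
  obtain ⟨σ, hσ, hae⟩ := (tendstoInMeasure_of_tendsto_eLpNorm (by norm_num)
    (fun j => (hcyl j).aestronglyMeasurable) hh2.1 hlim).exists_seq_tendsto_ae
  have hI1 : ∀ y : S.Hneg s → ℝ, AEStronglyMeasurable y ν →
      Integrable (fun u => G' u * ψ (y u)) ν := fun y hy =>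
    (integrable_const (C * B)).mono' (hGm'.aestronglyMeasurable.mul
      (hψc.comp_aestronglyMeasurable hy)) (ae_of_all _ fun u => by
        rw [norm_mul]; exact mul_le_mul (hGC' u) (hψB _) (norm_nonneg _) hC0)
  have hGψ' : ∀ x u, ‖G u * ψ' x‖ ≤ C * B := fun x u => by
    rw [norm_mul]; exact mul_le_mul (hGC u) (hψB' _) (norm_nonneg _) hC0
  have hGψ : ∀ x u, ‖G u * ψ x‖ ≤ C * B := fun x u => by
    rw [norm_mul]; exact mul_le_mul (hGC u) (hψB _) (norm_nonneg _) hC0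
  -- The integrand with the limit gradient `g` already in place but the function `y` still free:
  -- along `y = F_j` it is dominated by one integrable function.
  let E : (S.Hneg s → ℝ) → S.Hneg s → ℝ := fun y u =>
    G' u * ψ (y u) + G u * ψ' (y u) * S.rcoord s k c (g u)
      - S.lam k * (S.rcoord s k c u * (G u * ψ (y u)))
  have hlim1 : Tendsto (fun i => ∫ u, E (S.cyl s (φ (σ i))) u ∂ν) atTop (𝓝 (∫ u, E h u ∂ν)) := by
    refine tendsto_integral_of_dominated_convergence
      (fun u => C * B + C * B * ‖S.rcoord s k c (g u)‖ +
        S.lam k * (‖S.rcoord s k c u‖ * (C * B))) (fun i => ?_) ?_ (fun i => ?_) ?_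
    · exact ((hGm'.mul (hψh _)).aestronglyMeasurable.add
        ((hGm.mul (hψh' _)).aestronglyMeasurable.mul hgx.1)).sub
        ((((S.continuous_rcoord s k c).mul (hGm.mul (hψh _))).aestronglyMeasurable).const_mul _)
    · exact ((integrable_const _).add (hgxi.norm.const_mul _)).add
        ((hxi.norm.mul_const _).const_mul _)
    · refine ae_of_all _ fun u => (norm_sub_le _ _).trans
        (add_le_add ((norm_add_le _ _).trans (add_le_add ?_ ?_)) ?_)
      · rw [norm_mul]; exact mul_le_mul (hGC' u) (hψB _) (norm_nonneg _) hC0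
      · rw [norm_mul]; exact mul_le_mul_of_nonneg_right (hGψ' _ u) (norm_nonneg _)
      · rw [norm_mul, Real.norm_of_nonneg (S.lam_pos k).le, norm_mul]
        exact mul_le_mul_of_nonneg_left (mul_le_mul_of_nonneg_left (hGψ _ u) (norm_nonneg _))
          (S.lam_pos k).le
    · filter_upwards [hae] with u hu
      have h1 := (hψc.tendsto _).comp hu
      have h2 := (hψ'.tendsto _).comp hu
      exact ((h1.const_mul _).add ((h2.const_mul _).mul_const _)).sub
        (((h1.const_mul _).const_mul _).const_mul _)
  -- The error made by using `g` instead of `∇F_j`. It is at most a constant times `‖∇F_j - g‖`, and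
  -- `L²` norms dominate `L¹` norms under the probability measure `ν`.
  let R : ℕ → S.Hneg s → ℝ := fun j u =>
    G u * ψ' (S.cyl s (φ j) u) * (S.rcoord s k c (g u) - D j u)
  have hDi : ∀ j, Integrable (D j) ν := fun j => by
    obtain ⟨M, hM⟩ := hDB j
    exact (integrable_const M).mono' (hD j).aestronglyMeasurable (ae_of_all _ hM)
  have hER : ∀ j, ∫ u, E (S.cyl s (φ j)) u ∂ν = ∫ u, R j u ∂ν := fun j => by
    have i1 : Integrable (fun u => G' u * ψ (S.cyl s (φ j) u) +
        G u * ψ' (S.cyl s (φ j) u) * D j u) ν :=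
      (hI1 _ (hcyl j).aestronglyMeasurable).add
        ((hDi j).bdd_mul (hGm.mul (hψh' j)).aestronglyMeasurable (ae_of_all _ fun u => hGψ' _ u))
    have i2 : Integrable (fun u => S.lam k *
        (S.rcoord s k c u * (G u * ψ (S.cyl s (φ j) u)))) ν :=
      (hxi.mul_bdd (hGm.mul (hψh j)).aestronglyMeasurable
        (ae_of_all _ fun u => hGψ _ u)).const_mul _
    have i3 : Integrable (R j) ν :=
      (hgxi.sub (hDi j)).bdd_mul (hGm.mul (hψh' j)).aestronglyMeasurable
        (ae_of_all _ fun u => hGψ' _ u)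
    have h0 := key j
    rw [← integral_const_mul, ← sub_eq_zero, ← integral_sub i1 i2] at h0
    have h1 := integral_add (i1.sub i2) i3
    simp only [Pi.sub_apply] at h1
    rw [h0, zero_add] at h1
    rw [← h1]
    congr 1
    funext u
    simp only [E, R]
    ring
  have hlim2 : Tendsto (fun j => ∫ u, R j u ∂ν) atTop (𝓝 0) := by
    rw [tendsto_zero_iff_enorm_tendsto_zero]
    have hb : Tendsto (fun j => ENNReal.ofReal (C * B * ‖S.coordL s k‖) *
        eLpNorm (fun u => S.emb s (S.cylGrad s (φ j) u) - g u) 2 ν) atTop (𝓝 0) := by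
      simpa using ENNReal.Tendsto.const_mul hlim' (Or.inr ENNReal.ofReal_ne_top)
    refine tendsto_of_tendsto_of_tendsto_of_le_of_le tendsto_const_nhds hb (fun j => zero_le)
      fun j => ?_
    have hRm : AEStronglyMeasurable (R j) ν :=
      (hGm.mul (hψh' j)).aestronglyMeasurable.mul (hgx.1.sub (hD j).aestronglyMeasurable)
    calc ‖∫ u, R j u ∂ν‖ₑ ≤ ∫⁻ u, ‖R j u‖ₑ ∂ν := enorm_integral_le_lintegral_enorm _
      _ = eLpNorm (R j) 1 ν := eLpNorm_one_eq_lintegral_enorm.symm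
      _ ≤ eLpNorm (R j) 2 ν := eLpNorm_le_eLpNorm_of_exponent_le (by norm_num) hRm
      _ ≤ _ := eLpNorm_le_mul_eLpNorm_of_ae_le_mul (ae_of_all _ fun u => by
          simp only [R, D]
          rw [norm_mul, mul_assoc, ← rcoord_sub, ← norm_sub_rev (g u)]
          exact mul_le_mul (hGψ' _ u) (S.norm_rcoord_le s k hc _) (norm_nonneg _)
            (by positivity)) 2
  refine tendsto_nhds_unique hlim1 ?_
  simp only [hER]
  exact hlim2.comp hσ.tendsto_atTop

/-- A bounded approximation of `r ↦ e^{-r}`. -/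
def expApprox (N : ℕ) (r : ℝ) : ℝ := (Real.exp r + ((N : ℝ) + 1)⁻¹)⁻¹

theorem hasDerivAt_expApprox (N : ℕ) (r : ℝ) :
    HasDerivAt (expApprox N) (-(Real.exp r * expApprox N r ^ 2)) r := by
  have h := ((Real.hasDerivAt_exp r).add_const (((N : ℝ) + 1)⁻¹)).inv (by positivity)
  refine h.congr_deriv ?_
  rw [expApprox, inv_pow, neg_div, div_eq_mul_inv]

theorem continuous_expApprox (N : ℕ) : Continuous (expApprox N) :=
  continuous_iff_continuousAt.2 fun x => (hasDerivAt_expApprox N x).continuousAt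

theorem expApprox_pos (N : ℕ) (r : ℝ) : 0 < expApprox N r := by unfold expApprox; positivity

theorem expApprox_le_exp (N : ℕ) (r : ℝ) : expApprox N r ≤ Real.exp (-r) := by
  rw [Real.exp_neg]
  exact inv_anti₀ (Real.exp_pos r) (le_add_of_nonneg_right (by positivity))

theorem expApprox_le (N : ℕ) (r : ℝ) : expApprox N r ≤ N + 1 := by
  rw [expApprox]
  exact inv_le_of_inv_le₀ (by positivity) (le_add_of_nonneg_left (Real.exp_pos r).le)

/-- As `e^r * expApprox N r ≤ 1`, the derivative is dominated by the function itself: hence by `N +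
1`, as needed for fixed `N`, and by `e^{-r}`, as needed uniformly in `N`. -/
theorem norm_exp_mul_expApprox_sq_le (N : ℕ) (r : ℝ) :
    ‖-(Real.exp r * expApprox N r ^ 2)‖ ≤ expApprox N r := by
  have h := expApprox_pos N r
  rw [norm_neg, Real.norm_of_nonneg (by positivity), pow_two, ← mul_assoc]
  refine mul_le_of_le_one_left h.le ?_
  calc Real.exp r * expApprox N r ≤ Real.exp r * Real.exp (-r) :=
        mul_le_mul_of_nonneg_left (expApprox_le_exp N r) (Real.exp_pos r).le
    _ = 1 := by rw [← Real.exp_add]; simp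

theorem tendsto_expApprox (r : ℝ) :
    Tendsto (fun N => expApprox N r) atTop (𝓝 (Real.exp (-r))) := by
  have h := (tendsto_one_div_add_atTop_nhds_zero_nat (𝕜 := ℝ)).const_add (Real.exp r)
  rw [add_zero] at h
  have h2 := h.inv₀ (Real.exp_pos r).ne'
  rw [← Real.exp_neg] at h2
  simpa [expApprox] using h2

/-- Integration by parts against `e^{-h} ν`, for `h` in the Gross-Sobolev space. -/
theorem integral_mul_exp_neg {S : SpectralSetup H} {s : ℝ≥0} {ν : Measure (S.Hneg s)}
    (hν : S.IsGaussian s ν) {h : S.Hneg s → ℝ} {g : S.Hneg s → S.Hneg s}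
    (hh : S.IsMalliavinDeriv s ν h g) (hexp : MemLp (fun u => Real.exp (-h u)) 2 ν)
    (k : ℕ) {c : ℂ} (hc : ‖c‖ = 1) {G G' : S.Hneg s → ℝ} {C : ℝ}
    (hG : ∀ u, HasDerivAt (fun r : ℝ => G (u + (r : ℂ) • S.dir s k c)) (G' u) 0)
    (hGm : Continuous G) (hGm' : Continuous G') (hGC : ∀ u, ‖G u‖ ≤ C)
    (hGC' : ∀ u, ‖G' u‖ ≤ C) :
    ∫ u, G u * (S.lam k * S.rcoord s k c u + S.rcoord s k c (g u)) * Real.exp (-h u) ∂ν =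
      ∫ u, G' u * Real.exp (-h u) ∂ν := by
  have := hν.1
  have hC0 : 0 ≤ C := (norm_nonneg _).trans (hGC 0)
  have hL := (S.lam_pos k).le
  have hx := hν.memLp_rcoord k hc
  have hgx := S.memLp_rcoord_comp s k hc hh.2.1
  -- Cauchy–Schwarz: this and the next line supply the dominating functions and are where `e^{-h} ∈
  -- L²` is needed rather than `L¹`.
  have hxe : Integrable (fun u => S.rcoord s k c u * Real.exp (-h u)) ν := hx.integrable_mul hexp
  have hge : Integrable (fun u => S.rcoord s k c (g u) * Real.exp (-h u)) ν :=
    hgx.integrable_mul hexp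
  have he : Integrable (fun u => Real.exp (-h u)) ν := hexp.integrable (by norm_num)
  have key := fun N => integral_deriv_mul_comp hν hh k hc hG hGm hGm' hGC hGC'
    (ψ := expApprox N) (B := N + 1) (hasDerivAt_expApprox N)
    (by have := continuous_expApprox N; fun_prop)
    (fun x => by
      rw [Real.norm_of_nonneg (expApprox_pos N x).le]; exact expApprox_le N x)
    (fun x => (norm_exp_mul_expApprox_sq_le N x).trans (expApprox_le N x))
  have hlim : Tendsto (fun N => ∫ u, (G' u * expApprox N (h u) +
      G u * (-(Real.exp (h u) * expApprox N (h u) ^ 2)) * S.rcoord s k c (g u)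
      - S.lam k * (S.rcoord s k c u * (G u * expApprox N (h u)))) ∂ν) atTop
      (𝓝 (∫ u, (G' u * Real.exp (-h u) +
      G u * (-(Real.exp (h u) * Real.exp (-h u) ^ 2)) * S.rcoord s k c (g u)
      - S.lam k * (S.rcoord s k c u * (G u * Real.exp (-h u)))) ∂ν)) := by
    have hm := hh.1.1
    refine tendsto_integral_of_dominated_convergence
      (fun u => C * Real.exp (-h u) + C * ‖S.rcoord s k c (g u) * Real.exp (-h u)‖ +
        S.lam k * (C * ‖S.rcoord s k c u * Real.exp (-h u)‖)) (fun N => ?_) ?_ (fun N => ?_) ?_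
    · have h1 := (continuous_expApprox N).comp_aestronglyMeasurable hm
      have h2 := Real.continuous_exp.comp_aestronglyMeasurable hm
      exact ((hGm'.aestronglyMeasurable.mul h1).add
        ((hGm.aestronglyMeasurable.mul (h2.mul (h1.pow 2)).neg).mul hgx.1)).sub
        ((hx.1.mul (hGm.aestronglyMeasurable.mul h1)).const_mul _)
    · exact ((he.const_mul _).add (hge.norm.const_mul _)).add ((hxe.norm.const_mul _).const_mul _)
    · refine ae_of_all _ fun u => (norm_sub_le _ _).trans
        (add_le_add ((norm_add_le _ _).trans (add_le_add ?_ ?_)) ?_)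
      · rw [norm_mul, Real.norm_of_nonneg (expApprox_pos N _).le]
        exact mul_le_mul (hGC' u) (expApprox_le_exp N _) (expApprox_pos N _).le hC0
      · rw [norm_mul, norm_mul, norm_mul, Real.norm_of_nonneg (Real.exp_pos _).le, mul_assoc,
          mul_comm ‖S.rcoord s k c (g u)‖]
        exact mul_le_mul (hGC u) (mul_le_mul_of_nonneg_right
          ((norm_exp_mul_expApprox_sq_le N _).trans (expApprox_le_exp N _)) (norm_nonneg _))
          (by positivity) hC0
      · rw [norm_mul, norm_mul, norm_mul, norm_mul, Real.norm_of_nonneg (Real.exp_pos _).le,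
          Real.norm_of_nonneg (expApprox_pos N _).le, Real.norm_of_nonneg hL,
          mul_left_comm ‖S.rcoord s k c u‖]
        refine mul_le_mul_of_nonneg_left ?_ hL
        exact mul_le_mul (hGC u) (mul_le_mul_of_nonneg_left (expApprox_le_exp N _)
          (norm_nonneg _)) (mul_nonneg (norm_nonneg _) (expApprox_pos N _).le) hC0
    · refine ae_of_all _ fun u => ?_
      have h1 := tendsto_expApprox (h u)
      exact ((h1.const_mul _).add ((((h1.pow 2).const_mul _).neg.const_mul _).mul_const _)).sub
        (((h1.const_mul _).const_mul _).const_mul _)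
  simp only [key] at hlim
  have h0 := tendsto_nhds_unique hlim tendsto_const_nhds
  rw [← sub_eq_zero, ← neg_eq_zero, neg_sub, ← integral_sub, ← h0]
  · congr 1
    funext u
    -- The limit of `ψ_N'` is indeed the derivative `-e^{-r}` of `e^{-r}`.
    have h1 : Real.exp (h u) * Real.exp (-h u) ^ 2 = Real.exp (-h u) := by
      rw [pow_two, ← mul_assoc, ← Real.exp_add]; simp
    rw [h1]
    ring
  · exact he.bdd_mul hGm'.aestronglyMeasurable (ae_of_all _ hGC')
  · refine (((hxe.const_mul (S.lam k)).add hge).bdd_mul hGm.aestronglyMeasurable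
      (ae_of_all _ hGC)).congr (ae_of_all _ fun u => ?_)
    simp only [Pi.add_apply]
    ring

/-! ### The Gibbs measure -/

section Gibbs

variable {S : SpectralSetup H} {s : ℝ≥0} {ν : Measure (S.Hneg s)} {h : S.Hneg s → ℝ}

theorem lintegral_exp_neg_ne_zero [NeZero ν] (hm : AEMeasurable h ν) :
    ∫⁻ u, ENNReal.ofReal (Real.exp (-h u)) ∂ν ≠ 0 := by
  rw [Ne, lintegral_eq_zero_iff' (by fun_prop)]
  intro h0
  have : ∀ᵐ _ ∂ν, False := h0.mono fun u hu => by
    simp only [Pi.zero_apply, ENNReal.ofReal_eq_zero] at hu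
    exact hu.not_gt (Real.exp_pos _)
  rw [eventually_false_iff_eq_bot, ae_eq_bot] at this
  exact NeZero.ne ν this

theorem lintegral_exp_neg_ne_top (hexp : Integrable (fun u => Real.exp (-h u)) ν) :
    ∫⁻ u, ENNReal.ofReal (Real.exp (-h u)) ∂ν ≠ ⊤ :=
  hexp.lintegral_lt_top.ne

theorem isProbabilityMeasure_gibbs [NeZero ν] (hm : AEMeasurable h ν)
    (hexp : Integrable (fun u => Real.exp (-h u)) ν) :
    IsProbabilityMeasure (S.gibbs s ν h) := by
  constructor
  rw [gibbs, Measure.smul_apply, withDensity_apply _ MeasurableSet.univ, Measure.restrict_univ,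
    smul_eq_mul]
  exact ENNReal.inv_mul_cancel (lintegral_exp_neg_ne_zero hm) (lintegral_exp_neg_ne_top hexp)

theorem gibbs_absolutelyContinuous : S.gibbs s ν h ≪ ν :=
  (withDensity_absolutelyContinuous _ _).smul_left _

theorem integrable_gibbs [NeZero ν] (hm : AEMeasurable h ν) {f : S.Hneg s → ℝ}
    (hf : Integrable (fun u => f u * Real.exp (-h u)) ν) : Integrable f (S.gibbs s ν h) := by
  refine Integrable.smul_measure ?_ (ENNReal.inv_ne_top.2 (lintegral_exp_neg_ne_zero hm))
  rw [integrable_withDensity_iff_integrable_smul₀' (by fun_prop)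
    (ae_of_all _ fun _ => ENNReal.ofReal_lt_top)]
  refine hf.congr (ae_of_all _ fun u => ?_)
  simp only
  rw [ENNReal.toReal_ofReal (Real.exp_pos _).le, smul_eq_mul, mul_comm]

theorem integral_gibbs (hm : AEMeasurable h ν) (f : S.Hneg s → ℝ) :
    ∫ u, f u ∂(S.gibbs s ν h) =
      ((∫⁻ u, ENNReal.ofReal (Real.exp (-h u)) ∂ν)⁻¹).toReal *
        ∫ u, f u * Real.exp (-h u) ∂ν := by
  rw [gibbs, integral_smul_measure, integral_withDensity_eq_integral_toReal_smul₀ (by fun_prop)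
    (ae_of_all _ fun _ => ENNReal.ofReal_lt_top), smul_eq_mul]
  congr 2
  funext u
  rw [ENNReal.toReal_ofReal (Real.exp_pos _).le, smul_eq_mul, mul_comm]

/-- Cauchy–Schwarz against the density: this makes coordinates and `∇h` integrable under the Gibbs
measure. -/
theorem integrable_gibbs_of_memLp [NeZero ν] (hm : AEMeasurable h ν)
    (hexp : MemLp (fun u => Real.exp (-h u)) 2 ν) {E : Type*} [NormedAddCommGroup E]
    {f : S.Hneg s → E} (hf : MemLp f 2 ν) : Integrable f (S.gibbs s ν h) :=
  (integrable_norm_iff (hf.1.mono_ac gibbs_absolutelyContinuous)).1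
    (integrable_gibbs hm (hf.norm.integrable_mul hexp))

end Gibbs

/-! ### Stationarity -/

theorem IsCbInfty.snd_fderiv_bounded {n : ℕ} {φ : (Fin n → ℂ) → ℝ} (hφ : IsCbInfty φ) :
    ∃ C, ∀ z, ‖fderiv ℝ (fderiv ℝ φ) z‖ ≤ C := by
  obtain ⟨C, hC⟩ := hφ.2 2
  refine ⟨C, fun z => ?_⟩
  rw [← norm_iteratedFDeriv_one, norm_iteratedFDeriv_fderiv]
  exact hC z

theorem IsCbInfty.contDiff_fderiv {n : ℕ} {φ : (Fin n → ℂ) → ℝ} (hφ : IsCbInfty φ) :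
    ContDiff ℝ ∞ (fderiv ℝ φ) := hφ.1.fderiv_right (by simp)

theorem coord_dir_eq_single (S : SpectralSetup H) (s : ℝ≥0) {n : ℕ} (k : Fin n) (c : ℂ) :
    (fun j : Fin n => S.coord s (S.dir s k c) j) = Pi.single k c := by
  funext j
  rw [coord_dir, Pi.single_apply]
  simp only [Fin.val_inj]

theorem integrable_mul_gradient_exp_neg {S : SpectralSetup H} {s : ℝ≥0} {ν : Measure (S.Hneg s)}
    (hν : S.IsGaussian s ν) {h : S.Hneg s → ℝ} {g : S.Hneg s → S.Hneg s} (hg : MemLp g 2 ν)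
    (hexp : MemLp (fun u => Real.exp (-h u)) 2 ν) (k : ℕ) {c : ℂ} (hc : ‖c‖ = 1)
    {G : S.Hneg s → ℝ} {C : ℝ} (hGm : Continuous G) (hGC : ∀ u, ‖G u‖ ≤ C) :
    Integrable (fun u =>
      G u * (S.lam k * S.rcoord s k c u + S.rcoord s k c (g u)) * Real.exp (-h u)) ν := by
  have h1 := ((hν.memLp_rcoord k hc).const_mul (S.lam k)).add (S.memLp_rcoord_comp s k hc hg)
  refine ((h1.integrable_mul hexp).bdd_mul hGm.aestronglyMeasurable
    (ae_of_all _ hGC)).congr (ae_of_all _ fun u => ?_)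
  simp only [Pi.add_apply, Pi.mul_apply, mul_assoc]

/-- The integration by parts formula for a partial derivative of `φ`. -/
theorem integral_partial_mul_exp_neg {S : SpectralSetup H} {s : ℝ≥0} {ν : Measure (S.Hneg s)}
    (hν : S.IsGaussian s ν) {h : S.Hneg s → ℝ} {g : S.Hneg s → S.Hneg s}
    (hh : S.IsMalliavinDeriv s ν h g) (hexp : MemLp (fun u => Real.exp (-h u)) 2 ν)
    {n : ℕ} {φ : (Fin n → ℂ) → ℝ} (hφ : IsCbInfty φ) (k : Fin n) (b : ℂ) {c : ℂ} (hc : ‖c‖ = 1) :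
    Integrable (fun u => fderiv ℝ φ (fun j => S.coord s u j) (Pi.single k b) *
      (S.lam k * S.rcoord s k c u + S.rcoord s k c (g u)) * Real.exp (-h u)) ν ∧
    ∫ u, fderiv ℝ φ (fun j => S.coord s u j) (Pi.single k b) *
      (S.lam k * S.rcoord s k c u + S.rcoord s k c (g u)) * Real.exp (-h u) ∂ν =
    ∫ u, fderiv ℝ (fderiv ℝ φ) (fun j => S.coord s u j) (Pi.single k c) (Pi.single k b) *
      Real.exp (-h u) ∂ν := by
  obtain ⟨C1, hC1⟩ := hφ.fderiv_bounded
  obtain ⟨C2, hC2⟩ := hφ.snd_fderiv_bounded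
  have hcoord : Continuous fun (u : S.Hneg s) (j : Fin n) => S.coord s u j := by fun_prop
  have hd : Differentiable ℝ (fderiv ℝ φ) := hφ.contDiff_fderiv.differentiable (by simp)
  have hG : ∀ u : S.Hneg s, ‖fderiv ℝ φ (fun j => S.coord s u j) (Pi.single k b)‖ ≤
      C1 * ‖(Pi.single k b : Fin n → ℂ)‖ := fun u =>
    (ContinuousLinearMap.le_opNorm _ _).trans (mul_le_mul_of_nonneg_right (hC1 _) (norm_nonneg _))
  have hG' : ∀ u : S.Hneg s,
      ‖fderiv ℝ (fderiv ℝ φ) (fun j => S.coord s u j) (Pi.single k c) (Pi.single k b)‖ ≤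
      C2 * ‖(Pi.single k c : Fin n → ℂ)‖ * ‖(Pi.single k b : Fin n → ℂ)‖ := fun u =>
    (ContinuousLinearMap.le_opNorm₂ _ _ _).trans (by gcongr; exact hC2 _)
  have hGm : Continuous fun u : S.Hneg s =>
      fderiv ℝ φ (fun j => S.coord s u j) (Pi.single k b) :=
    (hφ.continuous_fderiv.comp hcoord).clm_apply continuous_const
  have hGm' : Continuous fun u : S.Hneg s =>
      fderiv ℝ (fderiv ℝ φ) (fun j => S.coord s u j) (Pi.single k c) (Pi.single k b) :=
    (((hφ.contDiff_fderiv.continuous_fderiv (by simp)).comp hcoord).clm_apply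
      continuous_const).clm_apply continuous_const
  refine ⟨integrable_mul_gradient_exp_neg hν hh.2.1 hexp k hc hGm hG,
    integral_mul_exp_neg hν hh hexp k hc (fun u => ?_) hGm hGm'
      (fun u => (hG u).trans (le_max_left _ _)) (fun u => (hG' u).trans (le_max_right _ _))⟩
  have h1 := S.hasDerivAt_comp_coord s (P := fun z => fderiv ℝ φ z (Pi.single k b))
    (fun z => (hd z).clm_apply (differentiableAt_const _)) k c u
  rw [coord_dir_eq_single] at h1
  refine h1.congr_deriv ?_
  rw [fderiv_clm_apply (hd _) (differentiableAt_const _)]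
  simp

/-- Multiplication by `-i` sends `(x, y)` to `(y, -x)`, so each partial derivative of `φ` meets the
gradient in the conjugate direction. -/
theorem pairing_hamiltonian_field (S : SpectralSetup H) (s : ℝ≥0) {n : ℕ} (φ : (Fin n → ℂ) → ℝ)
    (u v : S.Hneg s) :
    S.pairing (fun k => -I * S.applyA (S.coord s u) k - I * S.coord s v k) (S.cylGrad s φ u) =
      ∑ k : Fin n, (fderiv ℝ φ (fun j => S.coord s u j) (Pi.single k 1) *
          (S.lam k * S.rcoord s k I u + S.rcoord s k I v) -
        fderiv ℝ φ (fun j => S.coord s u j) (Pi.single k I) *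
          (S.lam k * S.rcoord s k 1 u + S.rcoord s k 1 v)) := by
  rw [pairing_cylGrad, linear_eq_sum_single]
  refine Finset.sum_congr rfl fun k _ => ?_
  simp [applyA, rcoord]
  ring

/-- After integration by parts the two terms for each `k` are the mixed second derivatives of `φ` in
opposite orders, and cancel by symmetry. -/
theorem stationarity {S : SpectralSetup H} {s : ℝ≥0} {ν : Measure (S.Hneg s)}
    (hν : S.IsGaussian s ν) {h : S.Hneg s → ℝ} {g : S.Hneg s → S.Hneg s}
    (hh : S.IsMalliavinDeriv s ν h g) (hexp : MemLp (fun u => Real.exp (-h u)) 2 ν)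
    {n : ℕ} {φ : (Fin n → ℂ) → ℝ} (hφ : IsCbInfty φ) :
    Integrable (fun u => S.pairing
        (fun k => -I * S.applyA (S.coord s u) k - I * S.coord s (g u) k)
        (S.cylGrad s φ u)) (S.gibbs s ν h) ∧
      ∫ u, S.pairing (fun k => -I * S.applyA (S.coord s u) k - I * S.coord s (g u) k)
        (S.cylGrad s φ u) ∂(S.gibbs s ν h) = 0 := by
  have := hν.1
  have hm := hh.1.1.aemeasurable
  simp only [pairing_hamiltonian_field]
  have h1 := fun k : Fin n => integral_partial_mul_exp_neg hν hh hexp hφ k 1 (c := I) (by simp)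
  have h2 := fun k : Fin n => integral_partial_mul_exp_neg hν hh hexp hφ k I (c := 1) (by simp)
  have h3 : ∀ k : Fin n, Integrable (fun u => (fderiv ℝ φ (fun j => S.coord s u j) (Pi.single k 1) *
          (S.lam k * S.rcoord s k I u + S.rcoord s k I (g u)) -
        fderiv ℝ φ (fun j => S.coord s u j) (Pi.single k I) *
          (S.lam k * S.rcoord s k 1 u + S.rcoord s k 1 (g u))) * Real.exp (-h u)) ν := fun k => by
    simp only [sub_mul]
    exact (h1 k).1.sub (h2 k).1
  refine ⟨integrable_finsetSum _ fun k _ => integrable_gibbs hm (h3 k), ?_⟩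
  rw [integral_finsetSum _ fun k _ => integrable_gibbs hm (h3 k)]
  refine Finset.sum_eq_zero fun k _ => ?_
  rw [integral_gibbs hm]
  simp only [sub_mul]
  rw [integral_sub (h1 k).1 (h2 k).1, (h1 k).2, (h2 k).2]
  have hsymm : ∀ z, fderiv ℝ (fderiv ℝ φ) z (Pi.single k I) (Pi.single k 1) =
      fderiv ℝ (fderiv ℝ φ) z (Pi.single k 1) (Pi.single k I) := fun z =>
    (hφ.1.contDiffAt.isSymmSndFDerivAt
      (by rw [minSmoothness_of_isRCLikeNormedField]; exact WithTop.coe_le_coe.2 (le_top : (2 : ℕ∞) ≤ ⊤))).eq _ _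
  simp only [hsymm, sub_self, mul_zero]

/-! ### The Liouville equation -/

/-- The flow on finitely many coordinates. -/
def finFlow (S : SpectralSetup H) (n : ℕ) (t : ℝ) : (Fin n → ℂ) →L[ℝ] (Fin n → ℂ) :=
  ContinuousLinearMap.pi fun k => S.expMul t k • ContinuousLinearMap.proj (R := ℝ) k

theorem finFlow_apply (S : SpectralSetup H) {n : ℕ} (t : ℝ) (z : Fin n → ℂ) (k : Fin n) :
    S.finFlow n t z k = S.expMul t k * z k := rfl

theorem coord_flow_eq_finFlow (S : SpectralSetup H) (s : ℝ≥0) {n : ℕ} (t : ℝ) (u : S.Hneg s) :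
    (fun j : Fin n => S.coord s (S.flow s t u) j) = S.finFlow n t fun j => S.coord s u j := by
  funext j
  rw [coord_flow, finFlow_apply]

/-- Needed so that stationarity may be tested on `F ∘ e^{itA}`; the `m`-th derivative grows by at
most `‖L‖ ^ m`. -/
theorem IsCbInfty.comp_clm {n : ℕ} {φ : (Fin n → ℂ) → ℝ} (hφ : IsCbInfty φ)
    (L : (Fin n → ℂ) →L[ℝ] (Fin n → ℂ)) : IsCbInfty (φ ∘ L) := by
  refine ⟨hφ.1.comp L.contDiff, fun m => ?_⟩
  obtain ⟨C, hC⟩ := hφ.2 m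
  refine ⟨C * ∏ _i : Fin m, ‖L‖, fun z => ?_⟩
  rw [L.iteratedFDeriv_comp_right (hφ.1.of_le (mod_cast le_top)) z le_rfl]
  refine (ContinuousMultilinearMap.norm_compContinuousLinearMap_le _ _).trans ?_
  gcongr
  exact hC _

theorem norm_expMul (S : SpectralSetup H) (t : ℝ) (k : ℕ) : ‖S.expMul t k‖ = 1 := by
  rw [expMul, ← Complex.ofReal_mul, Complex.norm_exp_ofReal_mul_I]

theorem hasDerivAt_expMul (S : SpectralSetup H) (t : ℝ) (k : ℕ) :
    HasDerivAt (fun τ : ℝ => S.expMul τ k) (I * S.lam k * S.expMul t k) t := by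
  have h1 := ((Complex.ofRealCLM.hasDerivAt (x := t)).mul_const (S.lam k : ℂ)).mul_const I
  have h2 := h1.cexp
  refine h2.congr_deriv ?_
  simp only [Complex.ofRealCLM_apply, Complex.ofReal_one, one_mul, expMul]
  ring

theorem norm_pi_le_sum {n : ℕ} (a : Fin n → ℂ) : ‖a‖ ≤ ∑ k, ‖a k‖ :=
  (pi_norm_le_iff_of_nonneg (Finset.sum_nonneg fun _ _ => norm_nonneg _)).2 fun k =>
    Finset.single_le_sum (f := fun k => ‖a k‖) (fun _ _ => norm_nonneg _) (Finset.mem_univ k)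

theorem vectorField_flow (S : SpectralSetup H) (s : ℝ≥0) (g : S.Hneg s → S.Hneg s) (t : ℝ)
    (u : S.Hneg s) : S.vectorField s g t (S.flow s t u) = -(I • S.flow s t (g u)) := by
  rw [vectorField, flow_neg_flow]

/-- Consequently `∫ ‖v(t, ·)‖ dμ_t` does not depend on `t`. -/
theorem norm_vectorField_flow (S : SpectralSetup H) (s : ℝ≥0) (g : S.Hneg s → S.Hneg s) (t : ℝ)
    (u : S.Hneg s) : ‖S.vectorField s g t (S.flow s t u)‖ = ‖g u‖ := by
  rw [vectorField_flow, norm_neg, norm_smul, norm_I, one_mul, norm_flow]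

theorem coord_vectorField_flow (S : SpectralSetup H) (s : ℝ≥0) (g : S.Hneg s → S.Hneg s) (t : ℝ)
    (u : S.Hneg s) (k : ℕ) :
    S.coord s (S.vectorField s g t (S.flow s t u)) k = S.expMul t k * (-I * S.coord s (g u) k) := by
  rw [vectorField_flow, ← neg_smul, coord_smul, coord_flow]
  ring

theorem integral_gibbsAt (S : SpectralSetup H) (s : ℝ≥0) (ν : Measure (S.Hneg s))
    (h : S.Hneg s → ℝ) (t : ℝ) (f : S.Hneg s → ℝ) :
    ∫ u, f u ∂(S.gibbsAt s ν h t) = ∫ u, f (S.flow s t u) ∂(S.gibbs s ν h) :=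
  (S.measurableEmbedding_flow s t).integral_map f

theorem integrable_gibbsAt_iff (S : SpectralSetup H) (s : ℝ≥0) (ν : Measure (S.Hneg s))
    (h : S.Hneg s → ℝ) (t : ℝ) {E : Type*} [NormedAddCommGroup E] (f : S.Hneg s → E) :
    Integrable f (S.gibbsAt s ν h t) ↔
      Integrable (fun u => f (S.flow s t u)) (S.gibbs s ν h) :=
  (S.measurableEmbedding_flow s t).integrable_map_iff

theorem continuous_integral_gibbsAt (S : SpectralSetup H) (s : ℝ≥0) (ν : Measure (S.Hneg s))
    (h : S.Hneg s → ℝ) [IsFiniteMeasure (S.gibbs s ν h)]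
    (F : BoundedContinuousFunction (S.Hneg s) ℝ) :
    Continuous fun t : ℝ => ∫ u, F u ∂(S.gibbsAt s ν h t) := by
  simp only [integral_gibbsAt]
  exact continuous_of_dominated (bound := fun _ => ‖F‖)
    (fun t => (F.continuous.comp (S.flow s t).continuous).aestronglyMeasurable)
    (fun t => ae_of_all _ fun u => F.norm_coe_le_norm _) (integrable_const _)
    (ae_of_all _ fun u => F.continuous.comp (S.continuous_flow s u))

theorem integrable_vectorField (S : SpectralSetup H) (s : ℝ≥0) {ν : Measure (S.Hneg s)}
    {h : S.Hneg s → ℝ} {g : S.Hneg s → S.Hneg s} (hg : Integrable g (S.gibbs s ν h)) (t : ℝ) :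
    Integrable (S.vectorField s g t) (S.gibbsAt s ν h t) := by
  rw [integrable_gibbsAt_iff]
  simp only [vectorField_flow]
  exact (((S.flow s t).integrable_comp hg).smul I).neg

/-! ### Differentiating cylindrical averages along the flow -/

section Derivative

variable {S : SpectralSetup H} {s : ℝ≥0} {ν : Measure (S.Hneg s)} {h : S.Hneg s → ℝ}
  {n : ℕ} {φ : (Fin n → ℂ) → ℝ}

theorem integrable_fderiv_coord {μ : Measure (S.Hneg s)} (hφ : IsCbInfty φ) (t : ℝ)
    {a : Fin n → S.Hneg s → ℂ} (ha : ∀ k, Integrable (a k) μ) :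
    Integrable (fun u => fderiv ℝ φ (fun j => S.coord s (S.flow s t u) j) fun k => a k u) μ := by
  obtain ⟨M, hM⟩ := hφ.fderiv_bounded
  have hM0 : 0 ≤ M := (norm_nonneg _).trans (hM 0)
  have hc : Continuous fun (u : S.Hneg s) (j : Fin n) => S.coord s (S.flow s t u) j :=
    continuous_pi fun j => (S.continuous_coord s j).comp (S.flow s t).continuous
  have hb : Integrable (fun u => M * ∑ k, ‖a k u‖) μ :=
    (integrable_finsetSum _ fun k _ => (ha k).norm).const_mul _
  have hcl : Continuous fun p : ((Fin n → ℂ) →L[ℝ] ℝ) × (Fin n → ℂ) => p.1 p.2 := by fun_prop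
  refine hb.mono' ?_ (ae_of_all _ fun u => ?_)
  · exact hcl.comp_aestronglyMeasurable
      ((hφ.continuous_fderiv.comp hc).aestronglyMeasurable.prodMk
        (aemeasurable_pi_iff.2 fun k => (ha k).1.aemeasurable).aestronglyMeasurable)
  · exact (ContinuousLinearMap.le_opNorm _ _).trans
      (mul_le_mul (hM _) (norm_pi_le_sum _) (norm_nonneg _) hM0)

/-- Only the first `n` coordinates are seen, so the unbounded `A` enters through finitely many
eigenvalues. As the multipliers have modulus one, the time derivative has an integrable bound
independent of time. -/
theorem hasDerivAt_integral_cyl [IsFiniteMeasure (S.gibbs s ν h)]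
    (hcoord : ∀ k, Integrable (fun u => S.coord s u k) (S.gibbs s ν h)) (hφ : IsCbInfty φ) (t : ℝ) :
    HasDerivAt (fun τ : ℝ => ∫ u, S.cyl s φ u ∂(S.gibbsAt s ν h τ))
      (∫ u, fderiv ℝ φ (fun j => S.coord s (S.flow s t u) j)
        (fun k => S.expMul t k * (I * S.applyA (S.coord s u) k)) ∂(S.gibbs s ν h)) t := by
  obtain ⟨C, hC⟩ := hφ.bounded
  obtain ⟨M, hM⟩ := hφ.fderiv_bounded
  have hM0 : 0 ≤ M := (norm_nonneg _).trans (hM 0)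
  simp only [integral_gibbsAt]
  have hi := integrable_fderiv_coord (μ := S.gibbs s ν h) hφ t
    (a := fun k u => S.expMul t k * (I * S.applyA (S.coord s u) k))
    fun k => (((hcoord k).const_mul _).const_mul _).const_mul _
  have hb : Integrable (fun u => M * ∑ k : Fin n, S.lam k * ‖S.coord s u k‖) (S.gibbs s ν h) := by
    refine Integrable.const_mul (integrable_finsetSum _ fun k _ => ?_) M
    exact (hcoord k).norm.const_mul (S.lam k)
  have hcyl : ∀ τ : ℝ, Continuous fun u : S.Hneg s => S.cyl s φ (S.flow s τ u) := fun τ =>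
    hφ.1.continuous.comp
      (continuous_pi fun j => (S.continuous_coord s j).comp (S.flow s τ).continuous)
  refine (hasDerivAt_integral_of_dominated_loc_of_deriv_le (s := Set.univ)
    (bound := fun u => M * ∑ k : Fin n, S.lam k * ‖S.coord s u k‖)
    (F := fun τ u => S.cyl s φ (S.flow s τ u))
    (F' := fun τ u => fderiv ℝ φ (fun j => S.coord s (S.flow s τ u) j)
        fun k => S.expMul τ k * (I * S.applyA (S.coord s u) k))
    univ_mem (Eventually.of_forall fun τ => (hcyl τ).aestronglyMeasurable)
    ((integrable_const C).mono' (hcyl t).aestronglyMeasurable (ae_of_all _ fun u => hC _))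
    ?_ (ae_of_all _ fun u τ _ => ?_) ?_ (ae_of_all _ fun u τ _ => ?_)).2
  · exact hi.aestronglyMeasurable
  · refine (ContinuousLinearMap.le_opNorm _ _).trans
      (mul_le_mul (hM _) ((norm_pi_le_sum _).trans (le_of_eq ?_)) (norm_nonneg _) hM0)
    refine Finset.sum_congr rfl fun k _ => ?_
    rw [norm_mul, norm_expMul, norm_mul, norm_I, applyA, norm_mul, Complex.norm_real,
      Real.norm_of_nonneg (S.lam_pos k).le, one_mul, one_mul]
  · exact hb
  · have h1 : HasDerivAt (fun (τ : ℝ) (j : Fin n) => S.coord s (S.flow s τ u) j)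
        (fun k => S.expMul τ k * (I * S.applyA (S.coord s u) k)) τ := by
      rw [hasDerivAt_pi]
      intro k
      simp only [coord_flow]
      refine ((S.hasDerivAt_expMul τ k).mul_const (S.coord s u k)).congr_deriv ?_
      rw [applyA]
      ring
    exact (hφ.differentiable _).hasFDerivAt.comp_hasDerivAt τ h1

end Derivative

/-- Pulled back to `μ₀`, both sides are derivatives of `φ` at `e^{itA}u`, in the directions
`e^{itA}(iAu)` and `e^{itA}(-i∇h)`. The integral of their difference is the stationarity identity
for `F ∘ e^{itA}`. -/
theorem liouville {S : SpectralSetup H} {s : ℝ≥0} {ν : Measure (S.Hneg s)}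
    (hν : S.IsGaussian s ν) {h : S.Hneg s → ℝ} {g : S.Hneg s → S.Hneg s}
    (hh : S.IsMalliavinDeriv s ν h g) (hexp : MemLp (fun u => Real.exp (-h u)) 2 ν)
    {n : ℕ} {φ : (Fin n → ℂ) → ℝ} (hφ : IsCbInfty φ) (t : ℝ) :
    Integrable (fun u => S.pairing (S.coord s (S.vectorField s g t u)) (S.cylGrad s φ u))
        (S.gibbsAt s ν h t) ∧
      HasDerivAt (fun τ : ℝ => ∫ u, S.cyl s φ u ∂(S.gibbsAt s ν h τ))
        (∫ u, S.pairing (S.coord s (S.vectorField s g t u)) (S.cylGrad s φ u)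
          ∂(S.gibbsAt s ν h t)) t := by
  have := hν.1
  have hm := hh.1.1.aemeasurable
  have := isProbabilityMeasure_gibbs (S := S) (s := s) hm (hexp.integrable (by norm_num))
  have hg : Integrable g (S.gibbs s ν h) := integrable_gibbs_of_memLp hm hexp hh.2.1
  have hcoord : ∀ k, Integrable (fun u => S.coord s u k) (S.gibbs s ν h) := fun k =>
    integrable_gibbs_of_memLp hm hexp (hν.memLp_coord k)
  have hi1 := integrable_fderiv_coord (μ := S.gibbs s ν h) hφ t
    (a := fun k u => S.expMul t k * (-I * S.coord s (g u) k))
    fun k => (((S.coordL s k).integrable_comp hg).const_mul _).const_mul _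
  have hi2 := integrable_fderiv_coord (μ := S.gibbs s ν h) hφ t
    (a := fun k u => S.expMul t k * (I * S.applyA (S.coord s u) k))
    fun k => (((hcoord k).const_mul _).const_mul _).const_mul _
  rw [integrable_gibbsAt_iff, integral_gibbsAt]
  simp only [pairing_cylGrad, coord_vectorField_flow]
  refine ⟨hi1, ?_⟩
  have hder := hasDerivAt_integral_cyl hcoord hφ t
  have hstat := (stationarity hν hh hexp (hφ.comp_clm (S.finFlow n t))).2
  have hpt : ∀ u, S.pairing (fun k => -I * S.applyA (S.coord s u) k - I * S.coord s (g u) k)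
      (S.cylGrad s (φ ∘ S.finFlow n t) u) =
      fderiv ℝ φ (fun j => S.coord s (S.flow s t u) j)
        (fun k => S.expMul t k * (-I * S.coord s (g u) k)) -
      fderiv ℝ φ (fun j => S.coord s (S.flow s t u) j)
        (fun k => S.expMul t k * (I * S.applyA (S.coord s u) k)) := fun u => by
    rw [pairing_cylGrad, fderiv_comp _ (hφ.differentiable _) (S.finFlow n t).differentiableAt,
      ContinuousLinearMap.fderiv, ContinuousLinearMap.comp_apply, ← coord_flow_eq_finFlow,
      ← map_sub]
    congr 1
    funext k
    rw [finFlow_apply, Pi.sub_apply]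
    ring
  simp only [hpt] at hstat
  rw [integral_sub hi1 hi2, sub_eq_zero] at hstat
  rwa [hstat]

end SpectralSetup

end

/-! ### Stationarity and the Liouville equation, assembled -/

theorem mainTheorem6 {H : Type*} [NormedAddCommGroup H] [InnerProductSpace ℂ H] [CompleteSpace H]
    (S : SpectralSetup H) (s : ℝ≥0)
    (hs : Summable fun k => S.lam k ^ (-((s : ℝ) + 1)))
    (ν₀ : Measure (S.Hneg s)) (hν₀ : S.IsGaussian s ν₀)
    (h : S.Hneg s → ℝ) (gradh : S.Hneg s → S.Hneg s)
    (hh : S.IsMalliavinDeriv s ν₀ h gradh)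
    (hexp : MemLp (fun u => Real.exp (-h u)) 2 ν₀) :
    -- the Gibbs measure is a probability measure
    IsProbabilityMeasure (S.gibbs s ν₀ h) ∧
    -- stationarity of the Gibbs measure
    (∀ (n : ℕ) (φ : (Fin n → ℂ) → ℝ), SpectralSetup.IsCbInfty φ →
      Integrable (fun u => S.pairing
        (fun k => -I * S.applyA (S.coord s u) k - I * S.coord s (gradh u) k)
        (S.cylGrad s φ u)) (S.gibbs s ν₀ h) ∧
      ∫ u, S.pairing
        (fun k => -I * S.applyA (S.coord s u) k - I * S.coord s (gradh u) k)
        (S.cylGrad s φ u) ∂(S.gibbs s ν₀ h) = 0) ∧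
    -- narrow continuity of the curve of transported Gibbs measures
    (∀ F : BoundedContinuousFunction (S.Hneg s) ℝ,
      Continuous fun t : ℝ => ∫ u, F u ∂(S.gibbsAt s ν₀ h t)) ∧
    -- integrability of the vector field along the curve
    (∀ t : ℝ, Integrable (S.vectorField s gradh t) (S.gibbsAt s ν₀ h t)) ∧
    Integrable (fun t : ℝ =>
      (∫ u, ‖S.vectorField s gradh t u‖ ∂(S.gibbsAt s ν₀ h t)) / (1 + t ^ 2)) ∧
    -- the statistical Liouville equation
    (∀ (n : ℕ) (φ : (Fin n → ℂ) → ℝ), SpectralSetup.IsCbInfty φ → ∀ t : ℝ,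
      Integrable (fun u => S.pairing (S.coord s (S.vectorField s gradh t u)) (S.cylGrad s φ u))
        (S.gibbsAt s ν₀ h t) ∧
      HasDerivAt (fun τ : ℝ => ∫ u, S.cyl s φ u ∂(S.gibbsAt s ν₀ h τ))
        (∫ u, S.pairing (S.coord s (S.vectorField s gradh t u)) (S.cylGrad s φ u)
          ∂(S.gibbsAt s ν₀ h t)) t) := by
  have hνp := hν₀.1
  have hm := hh.1.1.aemeasurable
  have hprob : IsProbabilityMeasure (S.gibbs s ν₀ h) :=
    SpectralSetup.isProbabilityMeasure_gibbs hm (hexp.integrable (by norm_num))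
  have hg : Integrable gradh (S.gibbs s ν₀ h) :=
    SpectralSetup.integrable_gibbs_of_memLp hm hexp hh.2.1
  refine ⟨hprob, fun n φ hφ => SpectralSetup.stationarity hν₀ hh hexp hφ,
    S.continuous_integral_gibbsAt s ν₀ h, S.integrable_vectorField s hg, ?_,
    fun n φ hφ t => SpectralSetup.liouville hν₀ hh hexp hφ t⟩
  -- The inner integral becomes the constant `∫ ‖∇h‖ dμ₀`, leaving the integrability of `1 / (1 +
  -- t²)`.
  simp only [SpectralSetup.integral_gibbsAt, SpectralSetup.norm_vectorField_flow, div_eq_mul_inv]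
  exact integrable_inv_one_add_sq.const_mul _
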